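/- Let $\Theta\subset\mathbb R$ be compact, with upper Minkowski dimension $$\beta(\Theta)=\limsup_{\delta\to0^+}\frac{\log N(\delta)}{-\log\delta},$$ where $N(\delta)$ is the minimal number of closed balls of diameter $\delta$ needed to cover $\Theta$. Let $0<\alpha<1$, $C_1\ge1$, $C_2,C_3>0$, and let $\gamma:\mathbb R\times[0,1]\times\Theta\to\mathbb R$ satisfy $\gamma(x,0,\theta)=x$ and, for all $x,x'\in\mathbb R$, $t,t'\in[0,1]$, $\theta,\theta'\in\Theta$: (C1) $x\mapsto\gamma(x,t,\theta)$ is $C^1$ and $C_1^{-1}|x-x'|\le|\gamma(x,t,\theta)-\gamma(x',t,\theta)|\le C_1|x-x'|$; (C2) $|\gamma(x,t,\theta)-\gamma(x,t',\theta)|\le C_2|t-t'|^\alpha$; (C3) $|\gamma(x,t,\theta)-\gamma(x,t,\theta')|\le C_3|\theta-\theta'|$. For $f\in L^2(\mathbb R)$ let $\hat f(\xi)=\int e^{-ix\xi}f(x)\,dx$ (extended to $L^2$), $\|f\|_{H^s}=\|(1+|\xi|^2)^{s/2}\hat f\|_{L^2}$ (so $f\in H^s(\mathbb R)$, $s\ge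 0$, means that this is finite), and $$e^{it\Delta}f(y)=\frac1{2\pi}\int_{\mathbb R}e^{i(y\xi+t\xi^2)}\hat f(\xi)\,d\xi ,$$ where the integral is understood as $\lim_{k\to\infty}\int_{|\xi|\le2^k}$; it is the ordinary Lebesgue integral if $\hat f$ is integrable. Let $x_0\in\mathbb R$, $r>0$, and consider, for $f\in H^s(\mathbb R)$, the maximal estimate $$\Bigl\|\sup_{t\in(0,1),\,\theta\in\Theta}|e^{it\Delta}f(\gamma(x,t,\theta))|\Bigr\|_{L^p_x(B(x_0,r))}\le C\|f\|_{H^s(\mathbb R)},\tag{$*$}$$ which is meant to include that for almost every $x\in B(x_0,r)$ the values $e^{it\Delta}f(\gamma(x,t,\theta))$, $t\in(0,1)$, $\theta\in\Theta$, are all defined, and that the supremum is a measurable function of $x$ (up to a null set). Then: (1) if $\alpha\in[1/2,1)$, then $(*)$ holds for $s>\frac{\beta(\Theta)+1}{4}$ and $p=4$; (2) if $\alpha\in(1/4,1/2)$, then $(*)$ holds for $s>\frac{\beta(\Theta)+1}{4}$ and $p=8\alpha$; (3) if $\alpha\in(0,1/4]$, then $(*)$ holds for $s>\alpha\beta(\Theta)+\frac12-\alpha$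 and $p=2$. Here $C$ depends only on $\alpha,s,C_1,C_2,C_3,\Theta$ and $B(x_0,r)$; in particular it depends neither on $f$ nor otherwise on $\gamma$. -/

import Mathlib

open MeasureTheory Filter Topology
open scoped FourierTransform NNReal ENNReal

noncomputable section

namespace SchrodingerCurves

/-- The minimal number of closed balls of diameter `δ` (closed intervals of length `δ`, with
arbitrary centres) that cover `Θ ⊆ ℝ`; for compact `Θ` and `δ > 0` this number is finite. -/
def coverCount (Θ : Set ℝ) (δ : ℝ) : ℕ :=
  (Metric.externalCoveringNumber (δ / 2).toNNReal Θ).toNat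

/-- The upper Minkowski dimension `limsup_{δ → 0⁺} log N(δ) / (- log δ)`. The quotient is bounded
near `0` when `Θ ⊆ ℝ` is bounded, so the real `limsup` is the genuine one for compact `Θ`. -/
def upperMinkowskiDim (Θ : Set ℝ) : ℝ :=
  limsup (fun δ : ℝ => Real.log (coverCount Θ δ) / (-Real.log δ)) (𝓝[>] (0 : ℝ))

/-- The Fourier transform `f̂(ξ) = ∫ e^{-ixξ} f(x) dx` of `f ∈ L²(ℝ)`, obtained from Mathlib's
`L²` Fourier transform (whose kernel is `e^{-2πixξ}`) by rescaling the frequency variable. -/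
def hat (f : Lp ℂ 2 (volume : Measure ℝ)) (ξ : ℝ) : ℂ :=
  (𝓕 f : Lp ℂ 2 (volume : Measure ℝ)) (ξ / (2 * Real.pi))

/-- The norm `‖f‖_{H^s} = ‖(1 + |ξ|²)^{s/2} f̂‖_{L²}`, with value `∞` if `f ∉ H^s(ℝ)`. -/
def sobolevNorm (s : ℝ) (f : Lp ℂ 2 (volume : Measure ℝ)) : ℝ≥0∞ :=
  eLpNorm (fun ξ : ℝ => (((1 + ξ ^ 2) ^ (s / 2) : ℝ) : ℂ) * hat f ξ) 2 volume

/-- For `s ≥ 0`: `f ∈ L²(ℝ)` belongs to `H^s(ℝ)`. -/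
def MemH (s : ℝ) (f : Lp ℂ 2 (volume : Measure ℝ)) : Prop :=
  sobolevNorm s f < ∞

/-- The part of `e^{itΔ} f (y) = (2π)⁻¹ ∫ e^{i(yξ + tξ²)} f̂(ξ) dξ` from frequencies
`|ξ| ≤ 2 ^ k`; the integral converges absolutely for every `f ∈ L²(ℝ)`. -/
def schrodingerTrunc (f : Lp ℂ 2 (volume : Measure ℝ)) (k : ℕ) (t y : ℝ) : ℂ :=
  (2 * Real.pi : ℂ)⁻¹ *
    ∫ ξ in Set.Icc (-(2 : ℝ) ^ k) ((2 : ℝ) ^ k),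
      Complex.exp (Complex.I * ((y * ξ + t * ξ ^ 2 : ℝ) : ℂ)) * hat f ξ

/-- `e^{itΔ} f (y) = (2π)⁻¹ ∫ e^{i(yξ + tξ²)} f̂(ξ) dξ`, the integral being the limit of the
integrals over `|ξ| ≤ 2 ^ k` (meaningful where that limit exists). It is the ordinary Lebesgue
integral whenever `f̂` is integrable, see `schrodinger_eq_integral`. -/
def schrodinger (f : Lp ℂ 2 (volume : Measure ℝ)) (t y : ℝ) : ℂ :=
  limUnder atTop fun k : ℕ => schrodingerTrunc f k t y

/-- The limit that defines `e^{itΔ} f (y)` exists. -/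
def SchrodingerDefinedAt (f : Lp ℂ 2 (volume : Measure ℝ)) (t y : ℝ) : Prop :=
  ∃ z : ℂ, Tendsto (fun k : ℕ => schrodingerTrunc f k t y) atTop (𝓝 z)

theorem tendsto_schrodingerTrunc_of_integrable (f : Lp ℂ 2 (volume : Measure ℝ))
    (hf : Integrable (hat f)) (t y : ℝ) :
    Tendsto (fun k : ℕ => schrodingerTrunc f k t y) atTop
      (𝓝 ((2 * Real.pi : ℂ)⁻¹ *
        ∫ ξ : ℝ, Complex.exp (Complex.I * ((y * ξ + t * ξ ^ 2 : ℝ) : ℂ)) * hat f ξ)) := by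
  have hpow : Tendsto (fun k : ℕ => (2 : ℝ) ^ k) atTop atTop :=
    tendsto_pow_atTop_atTop_of_one_lt one_lt_two
  have hcov : AECover (volume : Measure ℝ) atTop
      fun k : ℕ => Set.Icc (-(2 : ℝ) ^ k) ((2 : ℝ) ^ k) :=
    aecover_Icc (tendsto_neg_atTop_atBot.comp hpow) hpow
  refine Tendsto.const_mul _ (hcov.integral_tendsto_of_countably_generated ?_)
  refine hf.bdd_mul (c := 1) ?_ ?_
  · exact Continuous.aestronglyMeasurable (by fun_prop)
  · filter_upwards with ξ
    rw [mul_comm, Complex.norm_exp_ofReal_mul_I]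

theorem schrodinger_eq_integral (f : Lp ℂ 2 (volume : Measure ℝ))
    (hf : Integrable (hat f)) (t y : ℝ) :
    schrodinger f t y = (2 * Real.pi : ℂ)⁻¹ *
      ∫ ξ : ℝ, Complex.exp (Complex.I * ((y * ξ + t * ξ ^ 2 : ℝ) : ℂ)) * hat f ξ :=
  (tendsto_schrodingerTrunc_of_integrable f hf t y).limUnder_eq

/-- The conditions on a map `γ : ℝ × [0,1] × Θ → ℝ`, `(x, t, θ) ↦ γ x t θ` (values of `γ` outside
this domain are irrelevant): `γ x 0 θ = x`; `C¹` and bi-Lipschitz in `x` with constant `C₁`;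
`α`-Hölder in `t` with constant `C₂`; Lipschitz in `θ` with constant `C₃`. -/
structure IsCurveFamily (Θ : Set ℝ) (α C₁ C₂ C₃ : ℝ) (γ : ℝ → ℝ → ℝ → ℝ) : Prop where
  initial : ∀ x, ∀ θ ∈ Θ, γ x 0 θ = x
  contDiff : ∀ t ∈ Set.Icc (0 : ℝ) 1, ∀ θ ∈ Θ, ContDiff ℝ 1 fun x => γ x t θ
  bilipschitz : ∀ x x', ∀ t ∈ Set.Icc (0 : ℝ) 1, ∀ θ ∈ Θ,
    C₁⁻¹ * |x - x'| ≤ |γ x t θ - γ x' t θ| ∧ |γ x t θ - γ x' t θ| ≤ C₁ * |x - x'|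
  holder : ∀ x, ∀ t ∈ Set.Icc (0 : ℝ) 1, ∀ t' ∈ Set.Icc (0 : ℝ) 1, ∀ θ ∈ Θ,
    |γ x t θ - γ x t' θ| ≤ C₂ * |t - t'| ^ α
  lipschitz : ∀ x, ∀ t ∈ Set.Icc (0 : ℝ) 1, ∀ θ ∈ Θ, ∀ θ' ∈ Θ,
    |γ x t θ - γ x t θ'| ≤ C₃ * |θ - θ'|

/-- `x ↦ sup_{t ∈ (0,1), θ ∈ Θ} |e^{itΔ} f (γ(x,t,θ))|`. -/
def maximalFunction (Θ : Set ℝ) (γ : ℝ → ℝ → ℝ → ℝ) (f : Lp ℂ 2 (volume : Measure ℝ))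
    (x : ℝ) : ℝ≥0∞ :=
  ⨆ t ∈ Set.Ioo (0 : ℝ) 1, ⨆ θ ∈ Θ, ‖schrodinger f t (γ x t θ)‖ₑ

/-- The maximal estimate on `B(x₀, r)`, with a constant that serves all `γ` with the given
constants and all `f ∈ H^s(ℝ)`. It includes that, for almost every `x` in the ball, all the values
`e^{itΔ} f (γ(x,t,θ))` in the supremum are defined, and that the supremum is measurable. -/
def MaximalEstimate (Θ : Set ℝ) (α C₁ C₂ C₃ x₀ r s : ℝ) (p : ℝ≥0∞) : Prop :=
  ∃ C : ℝ≥0, ∀ γ : ℝ → ℝ → ℝ → ℝ, IsCurveFamily Θ α C₁ C₂ C₃ γ →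
    ∀ f : Lp ℂ 2 (volume : Measure ℝ), MemH s f →
      (∀ᵐ x ∂(volume.restrict (Metric.ball x₀ r)), ∀ t ∈ Set.Ioo (0 : ℝ) 1, ∀ θ ∈ Θ,
        SchrodingerDefinedAt f t (γ x t θ)) ∧
      AEMeasurable (maximalFunction Θ γ f) (volume.restrict (Metric.ball x₀ r)) ∧
      eLpNorm (maximalFunction Θ γ f) p (volume.restrict (Metric.ball x₀ r)) ≤
        C * sobolevNorm s f

end SchrodingerCurves

end

/- Linearise the supremum: choose `t`, `θ` as measurable functions of `x`. For a piece of `Θ` of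
diameter `ℓ^{-2α}` and frequencies `|ξ| ∼ ℓ`, the `TT*` method reduces the estimate to a bound for
the kernel `∫_{|ξ| ∼ ℓ} e^{i(yξ + tξ²)} dξ`, `y` and `t` being differences of two points on the
curves. The kernel is at most `ℓ`, at most `|t|^{-1/2}` by van der Corput, and at most
`(ℓ/|y|)^{1/2}` by integration by parts when the phase is nonstationary. Since `|x - x'| ≲ |y| +
|t|^α + ℓ^{-2α}` by (C1)-(C3), interpolation gives the bound `ℓ^{1 - 2ακ} |x - x'|^{-κ}`, whose
`q`-th power is locally integrable in `x'` as long as `κq < 1`; letting `κ` tend to `1/q` gives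
the estimate in `L^{2q}`.

Since `Θ` is covered by about `ℓ^{2αβ(Θ)}` such pieces, frequencies `|ξ| ∼ ℓ` cost, up to `ε`, the
power `1/2 - α(1 - β(Θ))/q` of `ℓ`. For `s` above that exponent the dyadic pieces sum
geometrically, which yields the estimate and, almost everywhere, uniform convergence of the
truncated integrals along the curves. For `α ≥ 1/2` only the `1/2`-Hölder continuity of the curves
in time is used. -/

namespace SchrodingerCurves

section OscillatoryIntegrals

/-- The oscillating factor `e^{i(yξ + tξ²)}` of the Schrödinger evolution. -/
noncomputable def phase (t y ξ : ℝ) : ℂ :=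
  Complex.exp (Complex.I * ((y * ξ + t * ξ ^ 2 : ℝ) : ℂ))

theorem norm_phase (t y ξ : ℝ) : ‖phase t y ξ‖ = 1 := by
  rw [phase, mul_comm, Complex.norm_exp_ofReal_mul_I]

theorem continuous_phase : Continuous fun z : ℝ × ℝ × ℝ => phase z.1 z.2.1 z.2.2 := by
  unfold phase
  fun_prop

theorem continuous_phase_right (t y : ℝ) : Continuous (phase t y) := by
  unfold phase
  fun_prop

theorem phase_mul_conj (t t' y y' ξ : ℝ) :
    phase t y ξ * (starRingEnd ℂ) (phase t' y' ξ) = phase (t - t') (y - y') ξ := by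
  simp only [phase, ← Complex.exp_conj, ← Complex.exp_add, map_mul, Complex.conj_I,
    Complex.conj_ofReal]
  congr 1
  push_cast
  ring

theorem hasDerivAt_phase (t y ξ : ℝ) :
    HasDerivAt (phase t y) (phase t y ξ * (Complex.I * ((y + 2 * t * ξ : ℝ) : ℂ))) ξ := by
  have hpoly : HasDerivAt (fun ξ : ℝ => y * ξ + t * ξ ^ 2) (y + 2 * t * ξ) ξ := by
    refine (((hasDerivAt_id ξ).const_mul y).add
      (((hasDerivAt_id ξ).pow 2).const_mul t)).congr_deriv ?_
    simp only [id_eq]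
    ring
  exact (hpoly.ofReal_comp.const_mul Complex.I).cexp

theorem norm_integral_phase_le_length (t y u v : ℝ) :
    ‖∫ ξ in u..v, phase t y ξ‖ ≤ |v - u| := by
  simpa using intervalIntegral.norm_integral_le_of_norm_le_const (a := u) (b := v)
    fun ξ _ => (norm_phase t y ξ).le

theorem hasDerivAt_inv_affine {a b ξ : ℝ} (h : a + b * ξ ≠ 0) :
    HasDerivAt (fun ξ => (a + b * ξ)⁻¹) (-b / (a + b * ξ) ^ 2) ξ := by
  simpa using (((hasDerivAt_id ξ).const_mul b).const_add a).fun_inv h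

variable {a b t y u v μ : ℝ}

theorem continuousOn_const_div_affine_sq (c : ℝ) (h : ∀ ξ ∈ Set.uIcc u v, a + b * ξ ≠ 0) :
    ContinuousOn (fun ξ => c / (a + b * ξ) ^ 2) (Set.uIcc u v) :=
  continuousOn_const.div (Continuous.continuousOn (by fun_prop)) fun ξ hξ =>
    pow_ne_zero 2 (h ξ hξ)

theorem integral_abs_div_affine_sq_le (hμ : 0 < μ) (h : ∀ ξ ∈ Set.uIcc u v, μ ≤ |a + b * ξ|) :
    ∫ ξ in u..v, |b| / (a + b * ξ) ^ 2 ≤ 2 / μ := by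
  have hne : ∀ ξ ∈ Set.uIcc u v, a + b * ξ ≠ 0 := fun ξ hξ =>
    abs_pos.1 (hμ.trans_le (h ξ hξ))
  have hinv : ∀ ξ ∈ Set.uIcc u v, |(a + b * ξ)⁻¹| ≤ 1 / μ := fun ξ hξ => by
    rw [abs_inv, one_div]
    exact inv_anti₀ hμ (h ξ hξ)
  have hFTC : ∫ ξ in u..v, -b / (a + b * ξ) ^ 2 = (a + b * v)⁻¹ - (a + b * u)⁻¹ :=
    intervalIntegral.integral_eq_sub_of_hasDerivAt (fun ξ hξ => hasDerivAt_inv_affine (hne ξ hξ))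
      (continuousOn_const_div_affine_sq (-b) hne).intervalIntegrable
  have habs : ∫ ξ in u..v, |b| / (a + b * ξ) ^ 2 ≤ |∫ ξ in u..v, -b / (a + b * ξ) ^ 2| := by
    rcases abs_choice b with hb | hb
    · rw [hb, ← abs_neg, ← intervalIntegral.integral_neg]
      simp only [neg_div, neg_neg]
      exact le_abs_self _
    · rw [hb]
      exact le_abs_self _
  calc _ ≤ |(a + b * v)⁻¹ - (a + b * u)⁻¹| := hFTC ▸ habs
    _ ≤ |(a + b * v)⁻¹| + |(a + b * u)⁻¹| := abs_sub _ _
    _ ≤ 1 / μ + 1 / μ := add_le_add (hinv v Set.right_mem_uIcc) (hinv u Set.left_mem_uIcc)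
    _ = 2 / μ := by ring

theorem integral_phase_eq_sub_add (h : ∀ ξ ∈ Set.uIcc u v, y + 2 * t * ξ ≠ 0) :
    ∫ ξ in u..v, phase t y ξ =
      -Complex.I * ((y + 2 * t * v)⁻¹ : ℝ) * phase t y v
        - -Complex.I * ((y + 2 * t * u)⁻¹ : ℝ) * phase t y u
        - ∫ ξ in u..v, -Complex.I * ((-(2 * t) / (y + 2 * t * ξ) ^ 2 : ℝ) : ℂ) * phase t y ξ := by
  rw [← intervalIntegral.integral_mul_deriv_eq_deriv_mul
    (fun ξ hξ => (hasDerivAt_inv_affine (h ξ hξ)).ofReal_comp.const_mul (-Complex.I))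
    (fun ξ _ => hasDerivAt_phase t y ξ)
    (continuousOn_const.mul (Complex.continuous_ofReal.comp_continuousOn
      (continuousOn_const_div_affine_sq _ h))).intervalIntegrable
    (((continuous_phase_right t y).mul (by fun_prop)).intervalIntegrable u v)]
  refine intervalIntegral.integral_congr fun ξ hξ => ?_
  have hne : ((y + 2 * t * ξ : ℝ) : ℂ) ≠ 0 := Complex.ofReal_ne_zero.2 (h ξ hξ)
  simp only [Complex.ofReal_inv]
  field_simp
  rw [Complex.I_sq]
  ring

theorem norm_integral_phase_le_of_le_deriv (huv : u ≤ v) (hμ : 0 < μ)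
    (h : ∀ ξ ∈ Set.Icc u v, μ ≤ |y + 2 * t * ξ|) :
    ‖∫ ξ in u..v, phase t y ξ‖ ≤ 4 / μ := by
  rw [← Set.uIcc_of_le huv] at h
  have hboundary : ∀ ξ ∈ Set.uIcc u v,
      ‖-Complex.I * ((y + 2 * t * ξ)⁻¹ : ℝ) * phase t y ξ‖ ≤ 1 / μ := fun ξ hξ => by
    rw [norm_mul, norm_mul, norm_phase, norm_neg, Complex.norm_I, one_mul, mul_one,
      Complex.norm_real, norm_inv, one_div]
    exact inv_anti₀ hμ (h ξ hξ)
  have hremainder : ‖∫ ξ in u..v,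
      -Complex.I * ((-(2 * t) / (y + 2 * t * ξ) ^ 2 : ℝ) : ℂ) * phase t y ξ‖ ≤ 2 / μ := by
    refine (intervalIntegral.norm_integral_le_integral_norm huv).trans
      (le_trans (le_of_eq ?_) (integral_abs_div_affine_sq_le hμ h))
    simp only [norm_mul, norm_phase, norm_neg, Complex.norm_I, one_mul, mul_one,
      Complex.norm_real, norm_div, norm_pow, Real.norm_eq_abs, sq_abs, abs_mul]
  rw [integral_phase_eq_sub_add fun ξ hξ => abs_pos.1 (hμ.trans_le (h ξ hξ))]
  calc _ ≤ 1 / μ + 1 / μ + 2 / μ :=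
        (norm_sub_le _ _).trans (add_le_add ((norm_sub_le _ _).trans
          (add_le_add (hboundary v Set.right_mem_uIcc) (hboundary u Set.left_mem_uIcc)))
          hremainder)
    _ = 4 / μ := by ring

theorem norm_integral_phase_le_of_le_abs_sub (huv : u ≤ v) (ht : t ≠ 0) {ρ : ℝ} (hρ : 0 < ρ)
    (h : ∀ ξ ∈ Set.Icc u v, ρ ≤ |ξ - -y / (2 * t)|) :
    ‖∫ ξ in u..v, phase t y ξ‖ ≤ 2 / (|t| * ρ) := by
  have hderiv : ∀ ξ, y + 2 * t * ξ = 2 * t * (ξ - -y / (2 * t)) := fun ξ => by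
    field_simp
    ring
  calc _ ≤ 4 / (2 * |t| * ρ) :=
        norm_integral_phase_le_of_le_deriv huv (by positivity) fun ξ hξ => by
          rw [hderiv, abs_mul, abs_mul, abs_two]
          exact mul_le_mul_of_nonneg_left (h ξ hξ) (by positivity)
    _ = 2 / (|t| * ρ) := by
        field_simp
        norm_num

theorem norm_integral_phase_le_add (y : ℝ) (huv : u ≤ v) (ht : t ≠ 0) {ρ : ℝ} (hρ : 0 < ρ) :
    ‖∫ ξ in u..v, phase t y ξ‖ ≤ 2 / (|t| * ρ) + (2 * ρ + 2 / (|t| * ρ)) := by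
  set c : ℝ := -y / (2 * t)
  set u₁ := max u (min v (c - ρ))
  set u₂ := max u₁ (min v (c + ρ))
  have huu₁ : u ≤ u₁ := le_max_left _ _
  have hu₁₂ : u₁ ≤ u₂ := le_max_left _ _
  have hu₂v : u₂ ≤ v := max_le (max_le huv (min_le_left _ _)) (min_le_left _ _)
  have hI : ∀ x y', IntervalIntegrable (phase t y) volume x y' := fun x y' =>
    (continuous_phase_right t y).intervalIntegrable x y'
  have hleft : ‖∫ ξ in u..u₁, phase t y ξ‖ ≤ 2 / (|t| * ρ) := by
    rcases huu₁.eq_or_lt with h | h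
    · rw [← h, intervalIntegral.integral_same, norm_zero]
      positivity
    · refine norm_integral_phase_le_of_le_abs_sub huu₁ ht hρ fun ξ hξ => ?_
      have : u₁ ≤ c - ρ := by grind
      rw [abs_sub_comm]
      exact le_trans (by linarith [hξ.2]) (le_abs_self _)
  have hmiddle : ‖∫ ξ in u₁..u₂, phase t y ξ‖ ≤ 2 * ρ := by
    refine (norm_integral_phase_le_length _ _ _ _).trans ?_
    rw [abs_of_nonneg (by linarith)]
    grind
  have hright : ‖∫ ξ in u₂..v, phase t y ξ‖ ≤ 2 / (|t| * ρ) := by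
    rcases hu₂v.eq_or_lt with h | h
    · rw [← h, intervalIntegral.integral_same, norm_zero]
      positivity
    · refine norm_integral_phase_le_of_le_abs_sub hu₂v ht hρ fun ξ hξ => ?_
      have : c + ρ ≤ u₂ := by grind
      exact le_trans (by linarith [hξ.1]) (le_abs_self _)
  rw [← intervalIntegral.integral_add_adjacent_intervals (hI u u₁) (hI u₁ v),
    ← intervalIntegral.integral_add_adjacent_intervals (hI u₁ u₂) (hI u₂ v)]
  exact (norm_add_le _ _).trans (add_le_add hleft
    ((norm_add_le _ _).trans (add_le_add hmiddle hright)))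

theorem norm_integral_phase_le_rpow (y : ℝ) (huv : u ≤ v) (ht : t ≠ 0) :
    ‖∫ ξ in u..v, phase t y ξ‖ ≤ 6 * |t| ^ (-(1 / 2) : ℝ) := by
  have ht' : 0 < |t| := abs_pos.2 ht
  set ρ : ℝ := |t| ^ (-(1 / 2) : ℝ) with hρ
  have hρ' : 0 < ρ := Real.rpow_pos_of_pos ht' _
  have hbalance : |t| * ρ = ρ⁻¹ := by
    rw [hρ, ← Real.rpow_neg ht'.le, ← Real.rpow_one_add' ht'.le (by norm_num)]
    norm_num
  calc _ ≤ 2 / (|t| * ρ) + (2 * ρ + 2 / (|t| * ρ)) := norm_integral_phase_le_add y huv ht hρ'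
    _ = 6 * ρ := by
        rw [hbalance, div_inv_eq_mul]
        ring

end OscillatoryIntegrals

section DualityMethod

variable {X Y : Type*} [MeasurableSpace X] [MeasurableSpace Y] {μ : Measure X} {ν : Measure Y}
  {q : ℝ}

theorem lintegral_prod_mul_fst_le [SFinite ν] {k : X → Y → ℝ≥0∞}
    (hk : Measurable (Function.uncurry k)) {A : ℝ≥0∞} (hA : ∀ x, ∫⁻ y, k x y ∂ν ≤ A)
    {W : X → ℝ≥0∞} (hW : Measurable W) :
    ∫⁻ z, k z.1 z.2 * W z.1 ∂(μ.prod ν) ≤ A * ∫⁻ x, W x ∂μ := by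
  rw [lintegral_prod (fun z => k z.1 z.2 * W z.1) (hk.mul (hW.comp measurable_fst)).aemeasurable]
  calc _ = ∫⁻ x, (∫⁻ y, k x y ∂ν) * W x ∂μ :=
        lintegral_congr fun x => lintegral_mul_const (W x) (hk.comp measurable_prodMk_left)
    _ ≤ ∫⁻ x, A * W x ∂μ := lintegral_mono fun x => mul_le_mul_left (hA x) _
    _ = A * ∫⁻ x, W x ∂μ := lintegral_const_mul _ hW

theorem lintegral_prod_mul_snd_le [SFinite μ] [SFinite ν] {k : X → Y → ℝ≥0∞}
    (hk : Measurable (Function.uncurry k)) {A : ℝ≥0∞} (hA : ∀ y, ∫⁻ x, k x y ∂μ ≤ A)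
    {W : Y → ℝ≥0∞} (hW : Measurable W) :
    ∫⁻ z, k z.1 z.2 * W z.2 ∂(μ.prod ν) ≤ A * ∫⁻ y, W y ∂ν := by
  rw [← lintegral_prod_swap]
  exact lintegral_prod_mul_fst_le (k := fun y x => k x y) (hk.comp measurable_swap) hA hW

theorem mul_rpow_mul_rpow_eq (hq : 1 ≤ q) (j w w' : ℝ≥0∞) :
    j * (w ^ (1 - 1 / (2 * q)) * w' ^ (1 - 1 / (2 * q))) =
      (j ^ q * w) ^ (1 / (2 * q)) * (j ^ q * w') ^ (1 / (2 * q)) * (w * w') ^ (1 - 1 / q) := by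
  have hq0 : 0 < q := one_pos.trans_le hq
  have h0 : 0 ≤ 1 / (2 * q) := by positivity
  have h1 : 0 ≤ 1 - 1 / q := sub_nonneg.2 ((div_le_one hq0).2 hq)
  have hw : ∀ w : ℝ≥0∞, w ^ (1 - 1 / (2 * q)) = w ^ (1 / (2 * q)) * w ^ (1 - 1 / q) := fun w => by
    rw [← ENNReal.rpow_add_of_nonneg _ _ h0 h1]
    congr 1
    field_simp
    ring
  have hj : j = (j ^ q) ^ (1 / (2 * q)) * (j ^ q) ^ (1 / (2 * q)) := by
    rw [← ENNReal.rpow_add_of_nonneg _ _ h0 h0, ← ENNReal.rpow_mul]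
    have : q * (1 / (2 * q) + 1 / (2 * q)) = 1 := by field_simp; norm_num
    rw [this, ENNReal.rpow_one]
  rw [hw, hw, ENNReal.mul_rpow_of_nonneg _ _ h0, ENNReal.mul_rpow_of_nonneg _ _ h0,
    ENNReal.mul_rpow_of_nonneg _ _ h1]
  nth_rewrite 1 [hj]
  ring

/- A bilinear form of Young's inequality, by Hölder's inequality with the exponents
`1 / (2q)`, `1 / (2q)` and `1 - 1 / q`. -/
theorem lintegral_kernel_mul_mul_le [SFinite μ] {J : X → X → ℝ≥0∞}
    (hJ : Measurable (Function.uncurry J)) (hq : 1 ≤ q) {A : ℝ≥0∞}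
    (hl : ∀ x, ∫⁻ x', J x x' ^ q ∂μ ≤ A) (hr : ∀ x', ∫⁻ x, J x x' ^ q ∂μ ≤ A)
    {W : X → ℝ≥0∞} (hW : Measurable W) :
    ∫⁻ z, J z.1 z.2 * (W z.1 ^ (1 - 1 / (2 * q)) * W z.2 ^ (1 - 1 / (2 * q))) ∂(μ.prod μ) ≤
      A ^ (1 / q) * (∫⁻ x, W x ∂μ) ^ (2 - 1 / q) := by
  have hq0 : 0 < q := one_pos.trans_le hq
  have h0 : 0 ≤ 1 / (2 * q) := by positivity
  have h1 : 0 ≤ 1 - 1 / q := sub_nonneg.2 ((div_le_one hq0).2 hq)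
  have hhalf : 1 / q = 1 / (2 * q) + 1 / (2 * q) := by field_simp; norm_num
  set Z := ∫⁻ x, W x ∂μ
  have hJq : Measurable (Function.uncurry fun x x' => J x x' ^ q) := hJ.pow_const q
  have hW₁ : Measurable fun z : X × X => W z.1 := hW.comp measurable_fst
  have hW₂ : Measurable fun z : X × X => W z.2 := hW.comp measurable_snd
  have holder := ENNReal.lintegral_prod_norm_pow_le (μ := μ.prod μ) (Finset.univ : Finset (Fin 3))
    (f := ![fun z => J z.1 z.2 ^ q * W z.1, fun z => J z.1 z.2 ^ q * W z.2,
      fun z => W z.1 * W z.2]) (p := ![1 / (2 * q), 1 / (2 * q), 1 - 1 / q])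
    (fun i _ => by
      fin_cases i
      exacts [(hJq.mul hW₁).aemeasurable, (hJq.mul hW₂).aemeasurable, (hW₁.mul hW₂).aemeasurable])
    (by
      rw [Fin.sum_univ_three, hhalf]
      simp)
    (fun i _ => by
      fin_cases i
      exacts [h0, h0, h1])
  simp only [Fin.prod_univ_three, Matrix.cons_val] at holder
  simp_rw [mul_rpow_mul_rpow_eq hq]
  calc _ ≤ _ := holder
    _ ≤ (A * Z) ^ (1 / (2 * q)) * (A * Z) ^ (1 / (2 * q)) * (Z * Z) ^ (1 - 1 / q) := by
        rw [lintegral_prod_mul hW.aemeasurable hW.aemeasurable]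
        gcongr
        · exact lintegral_prod_mul_fst_le hJq hl hW
        · exact lintegral_prod_mul_snd_le hJq hr hW
    _ = A ^ (1 / q) * Z ^ (2 - 1 / q) := by
        have hexp : 2 - 1 / q = 1 / q + (1 - 1 / q) + (1 - 1 / q) := by ring
        have hq1 : 0 ≤ 1 / q := by positivity
        rw [← ENNReal.rpow_add_of_nonneg _ _ h0 h0, ← hhalf, ENNReal.mul_rpow_of_nonneg _ _ hq1,
          ENNReal.mul_rpow_of_nonneg _ _ h1, hexp,
          ENNReal.rpow_add_of_nonneg _ _ (by positivity) h1, ENNReal.rpow_add_of_nonneg _ _ hq1 h1]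
        ring

theorem enorm_integral_ofReal_of_nonneg {u : X → ℝ} (hu : Integrable u μ) (h0 : ∀ x, 0 ≤ u x) :
    ‖∫ x, (u x : ℂ) ∂μ‖ₑ = ∫⁻ x, ENNReal.ofReal (u x) ∂μ := by
  rw [integral_complex_ofReal, ← ofReal_integral_eq_lintegral_ofReal hu (ae_of_all _ h0),
    ← ofReal_norm, Complex.norm_real, Real.norm_of_nonneg (integral_nonneg h0)]

theorem lintegral_enorm_rpow_eq_enorm_integral {S : X → ℂ} {p : ℝ} (hp : 0 ≤ p)
    (hS : Integrable (fun x => ‖S x‖ ^ p) μ) :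
    ∫⁻ x, ‖S x‖ₑ ^ p ∂μ = ‖∫ x, ((‖S x‖ ^ p : ℝ) : ℂ) ∂μ‖ₑ := by
  rw [enorm_integral_ofReal_of_nonneg hS fun x => by positivity]
  refine lintegral_congr fun x => ?_
  rw [← ENNReal.ofReal_rpow_of_nonneg (norm_nonneg _) hp, ofReal_norm]

theorem integrable_norm_rpow_of_norm_le [IsFiniteMeasure μ] {S : X → ℂ} (hS : Measurable S)
    {D p : ℝ} (hD : ∀ x, ‖S x‖ ≤ D) (hp : 0 ≤ p) : Integrable (fun x => ‖S x‖ ^ p) μ := by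
  refine Integrable.of_bound (hS.norm.pow_const p).aestronglyMeasurable (D ^ p)
    (ae_of_all _ fun x => ?_)
  rw [Real.norm_of_nonneg (by positivity)]
  exact Real.rpow_le_rpow (norm_nonneg _) (hD x) hp

theorem integral_integral_mul_conj [IsFiniteMeasure μ] [IsFiniteMeasure ν] {Ψ : X → Y → ℂ}
    (hΨ : Measurable (Function.uncurry Ψ)) {D : ℝ} (hD : ∀ x ξ, ‖Ψ x ξ‖ ≤ D) :
    ∫ ξ, (∫ x, Ψ x ξ ∂μ) * (starRingEnd ℂ) (∫ x, Ψ x ξ ∂μ) ∂ν =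
      ∫ z, (∫ ξ, Ψ z.1 ξ * (starRingEnd ℂ) (Ψ z.2 ξ) ∂ν) ∂(μ.prod μ) := by
  have hΨ' : Measurable fun w : Y × X => Ψ w.2 w.1 := hΨ.comp measurable_swap
  have hint : Integrable (Function.uncurry fun (ξ : Y) (z : X × X) =>
      Ψ z.1 ξ * (starRingEnd ℂ) (Ψ z.2 ξ)) (ν.prod (μ.prod μ)) := by
    refine Integrable.of_bound (Measurable.mul
      (hΨ'.comp (measurable_fst.prodMk (measurable_fst.comp measurable_snd)))
      (Complex.continuous_conj.measurable.comp (hΨ'.comp (measurable_fst.prodMk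
        (measurable_snd.comp measurable_snd))))).aestronglyMeasurable (D * D)
      (ae_of_all _ fun w => ?_)
    simp only [Function.uncurry, norm_mul, RCLike.norm_conj]
    exact mul_le_mul (hD _ _) (hD _ _) (norm_nonneg _) ((norm_nonneg _).trans (hD w.2.1 w.1))
  rw [← integral_integral_swap hint]
  refine integral_congr_ae (ae_of_all _ fun ξ => ?_)
  simp only [← integral_conj]
  exact (integral_prod_mul (fun x => Ψ x ξ) (fun x => (starRingEnd ℂ) (Ψ x ξ))).symm

theorem lintegral_enorm_dual_sq_le [IsFiniteMeasure μ] [IsFiniteMeasure ν] {Φ : X → Y → ℂ}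
    (hΦ : Measurable (Function.uncurry Φ)) (hΦ1 : ∀ x ξ, ‖Φ x ξ‖ ≤ 1) {J : X → X → ℝ≥0∞}
    (hK : ∀ᵐ z ∂(μ.prod μ), ‖∫ ξ, Φ z.1 ξ * (starRingEnd ℂ) (Φ z.2 ξ) ∂ν‖ₑ ≤ J z.1 z.2)
    {g : X → ℂ} (hg : Measurable g) {D : ℝ} (hD : ∀ x, ‖g x‖ ≤ D) :
    ∫⁻ ξ, ‖∫ x, Φ x ξ * g x ∂μ‖ₑ ^ (2 : ℝ) ∂ν ≤
      ∫⁻ z, J z.1 z.2 * (‖g z.1‖ₑ * ‖g z.2‖ₑ) ∂(μ.prod μ) := by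
  have hΨ : Measurable (Function.uncurry fun x ξ => Φ x ξ * g x) :=
    hΦ.mul (hg.comp measurable_fst)
  have hΨD : ∀ x ξ, ‖Φ x ξ * g x‖ ≤ D := fun x ξ => by
    rw [norm_mul]
    exact (mul_le_of_le_one_left (norm_nonneg _) (hΦ1 x ξ)).trans (hD x)
  have hS : Measurable fun ξ => ∫ x, Φ x ξ * g x ∂μ :=
    (hΨ.comp measurable_swap).stronglyMeasurable.integral_prod_right'.measurable
  have hsq : ∀ z : ℂ, ((‖z‖ ^ (2 : ℝ) : ℝ) : ℂ) = z * (starRingEnd ℂ) z := fun z => by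
    rw [Complex.mul_conj']
    norm_cast
  rw [lintegral_enorm_rpow_eq_enorm_integral zero_le_two (integrable_norm_rpow_of_norm_le hS
    (fun ξ => norm_integral_le_of_norm_le_const (ae_of_all _ fun x => hΨD x ξ)) zero_le_two)]
  simp_rw [hsq]
  rw [integral_integral_mul_conj hΨ hΨD]
  refine (enorm_integral_le_lintegral_enorm _).trans (lintegral_mono_ae ?_)
  filter_upwards [hK] with z hz
  calc _ = ‖(∫ ξ, Φ z.1 ξ * (starRingEnd ℂ) (Φ z.2 ξ) ∂ν) *
        (g z.1 * (starRingEnd ℂ) (g z.2))‖ₑ := by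
        rw [← integral_mul_const]
        congr 1
        refine integral_congr_ae (ae_of_all _ fun ξ => ?_)
        simp only [map_mul]
        ring
    _ ≤ _ := by
        rw [enorm_mul, enorm_mul, RCLike.enorm_conj]
        gcongr

/-- The density `z̄ |z|^{p-2}`, which pairs with `z` to `|z|^p`: it realises the duality between
`L^p` and its dual. -/
noncomputable def dualDensity (p : ℝ) (z : ℂ) : ℂ :=
  (starRingEnd ℂ) z * ((‖z‖ ^ (p - 2) : ℝ) : ℂ)

theorem measurable_dualDensity (p : ℝ) : Measurable (dualDensity p) :=
  Complex.continuous_conj.measurable.mul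
    (Complex.measurable_ofReal.comp (measurable_norm.pow_const _))

theorem norm_dualDensity {p : ℝ} (hp : p ≠ 1) (z : ℂ) :
    ‖dualDensity p z‖ = ‖z‖ ^ (p - 1) := by
  have hexp : p - 1 = 1 + (p - 2) := by ring
  rw [dualDensity, norm_mul, RCLike.norm_conj, Complex.norm_real,
    Real.norm_of_nonneg (by positivity), hexp, Real.rpow_one_add' (norm_nonneg _)]
  rwa [← hexp, sub_ne_zero]

theorem enorm_dualDensity {p : ℝ} (hp : 1 < p) (z : ℂ) :
    ‖dualDensity p z‖ₑ = (‖z‖ₑ ^ p) ^ (1 - 1 / p) := by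
  have hexp : p * (1 - 1 / p) = p - 1 := by field_simp
  rw [← ENNReal.rpow_mul, hexp, ← ofReal_norm, norm_dualDensity hp.ne', ← ofReal_norm,
    ENNReal.ofReal_rpow_of_nonneg (norm_nonneg _) (by linarith)]

theorem mul_dualDensity {p : ℝ} (hp : p ≠ 0) (z : ℂ) :
    z * dualDensity p z = ((‖z‖ ^ p : ℝ) : ℂ) := by
  rw [dualDensity, ← mul_assoc, Complex.mul_conj']
  norm_cast
  rw [← Real.rpow_natCast, ← Real.rpow_add' (norm_nonneg _) (by simpa using hp)]
  norm_num

theorem integral_mul_integral_comm [IsFiniteMeasure μ] [SFinite ν] {Φ : X → Y → ℂ}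
    (hΦ : Measurable (Function.uncurry Φ)) (hΦ1 : ∀ x ξ, ‖Φ x ξ‖ ≤ 1) {g : X → ℂ}
    (hg : Measurable g) {D : ℝ} (hD : ∀ x, ‖g x‖ ≤ D) {h : Y → ℂ} (hh : Integrable h ν) :
    ∫ x, (∫ ξ, Φ x ξ * h ξ ∂ν) * g x ∂μ = ∫ ξ, h ξ * ∫ x, Φ x ξ * g x ∂μ ∂ν := by
  have hint : Integrable (Function.uncurry fun x ξ => Φ x ξ * g x * h ξ) (μ.prod ν) := by
    refine (hh.comp_snd μ).bdd_mul (c := D) (hΦ.mul (hg.comp measurable_fst)).aestronglyMeasurable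
      (ae_of_all _ fun z => ?_)
    rw [norm_mul]
    exact (mul_le_of_le_one_left (norm_nonneg _) (hΦ1 _ _)).trans (hD _)
  calc _ = ∫ x, ∫ ξ, Φ x ξ * g x * h ξ ∂ν ∂μ := by
        simp_rw [← integral_mul_const, mul_right_comm]
    _ = ∫ ξ, ∫ x, Φ x ξ * g x * h ξ ∂μ ∂ν := integral_integral_swap hint
    _ = _ := by simp_rw [← integral_const_mul, mul_comm]

theorem le_mul_rpow_of_le_rpow_mul_rpow {Z H A : ℝ≥0∞} (hq : 1 ≤ q) (hZ : Z ≠ ∞)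
    (h : Z ≤ H ^ (1 / 2 : ℝ) * (A ^ (1 / q) * Z ^ (2 - 1 / q)) ^ (1 / 2 : ℝ)) :
    Z ≤ A * H ^ q := by
  have hq0 : 0 < q := one_pos.trans_le hq
  rcases eq_or_ne Z 0 with rfl | hZ0
  · exact zero_le
  have hpow : Z * Z ^ (2 * q - 1) ≤ A * H ^ q * Z ^ (2 * q - 1) := calc
    Z * Z ^ (2 * q - 1) = Z ^ (2 * q) := by
      nth_rewrite 1 [← ENNReal.rpow_one Z]
      rw [← ENNReal.rpow_add _ _ hZ0 hZ]
      ring_nf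
    _ ≤ (H ^ (1 / 2 : ℝ) * (A ^ (1 / q) * Z ^ (2 - 1 / q)) ^ (1 / 2 : ℝ)) ^ (2 * q) :=
      ENNReal.rpow_le_rpow h (by positivity)
    _ = A * H ^ q * Z ^ (2 * q - 1) := by
      have e₁ : 1 / 2 * (2 * q) = q := by ring
      have e₂ : 1 / q * q = 1 := by field_simp
      have e₃ : (2 - 1 / q) * q = 2 * q - 1 := by field_simp
      rw [ENNReal.mul_rpow_of_nonneg _ _ (by positivity), ← ENNReal.rpow_mul, ← ENNReal.rpow_mul,
        e₁, ENNReal.mul_rpow_of_nonneg _ _ hq0.le, ← ENNReal.rpow_mul, ← ENNReal.rpow_mul, e₂, e₃,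
        ENNReal.rpow_one]
      ring
  exact (ENNReal.mul_le_mul_iff_left (ENNReal.rpow_pos (pos_iff_ne_zero.2 hZ0) hZ).ne'
    (ENNReal.rpow_ne_top_of_nonneg (by linarith) hZ)).1 hpow

/- The `TT*` method for `T h = ∫ Φ(·, ξ) h(ξ) dξ` from `L²` to `L^{2q}`: pair `T h` with its dual
density and use that the kernel of `TT*` is dominated by `J`. -/
theorem lintegral_enorm_rpow_le_of_kernel_le [IsFiniteMeasure μ] [IsFiniteMeasure ν]
    {Φ : X → Y → ℂ} (hΦ : Measurable (Function.uncurry Φ)) (hΦ1 : ∀ x ξ, ‖Φ x ξ‖ ≤ 1)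
    {J : X → X → ℝ≥0∞} (hJ : Measurable (Function.uncurry J))
    (hK : ∀ᵐ z ∂(μ.prod μ), ‖∫ ξ, Φ z.1 ξ * (starRingEnd ℂ) (Φ z.2 ξ) ∂ν‖ₑ ≤ J z.1 z.2)
    (hq : 1 ≤ q) {A : ℝ≥0∞}
    (hl : ∀ x, ∫⁻ x', J x x' ^ q ∂μ ≤ A) (hr : ∀ x', ∫⁻ x, J x x' ^ q ∂μ ≤ A)
    {h : Y → ℂ} (hm : Measurable h) (hh : Integrable h ν) :
    ∫⁻ x, ‖∫ ξ, Φ x ξ * h ξ ∂ν‖ₑ ^ (2 * q) ∂μ ≤ A * (∫⁻ ξ, ‖h ξ‖ₑ ^ (2 : ℝ) ∂ν) ^ q := by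
  set F : X → ℂ := fun x => ∫ ξ, Φ x ξ * h ξ ∂ν
  have hF : Measurable F :=
    (hΦ.mul (hm.comp measurable_snd)).stronglyMeasurable.integral_prod_right'.measurable
  have hFD : ∀ x, ‖F x‖ ≤ ∫ ξ, ‖h ξ‖ ∂ν := fun x =>
    norm_integral_le_of_norm_le hh.norm (ae_of_all _ fun ξ => by
      rw [norm_mul]
      exact mul_le_of_le_one_left (norm_nonneg _) (hΦ1 x ξ))
  set g : X → ℂ := fun x => dualDensity (2 * q) (F x)
  have hg : Measurable g := (measurable_dualDensity _).comp hF
  have hgD : ∀ x, ‖g x‖ ≤ (∫ ξ, ‖h ξ‖ ∂ν) ^ (2 * q - 1) := fun x => by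
    rw [norm_dualDensity (by linarith)]
    exact Real.rpow_le_rpow (norm_nonneg _) (hFD x) (by linarith)
  have hint : Integrable (fun x => ‖F x‖ ^ (2 * q)) μ :=
    integrable_norm_rpow_of_norm_le hF hFD (by linarith)
  have hpairing : ∫⁻ x, ‖F x‖ₑ ^ (2 * q) ∂μ = ‖∫ ξ, h ξ * ∫ x, Φ x ξ * g x ∂μ ∂ν‖ₑ := by
    rw [lintegral_enorm_rpow_eq_enorm_integral (by linarith) hint,
      ← integral_mul_integral_comm hΦ hΦ1 hg hgD hh]
    simp_rw [← mul_dualDensity (show 2 * q ≠ 0 by linarith)]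
    rfl
  have hdual_meas : Measurable fun ξ => ∫ x, Φ x ξ * g x ∂μ :=
    ((hΦ.comp measurable_swap).mul
      (hg.comp measurable_snd)).stronglyMeasurable.integral_prod_right'.measurable
  have hcauchy : ‖∫ ξ, h ξ * ∫ x, Φ x ξ * g x ∂μ ∂ν‖ₑ ≤ (∫⁻ ξ, ‖h ξ‖ₑ ^ (2 : ℝ) ∂ν) ^ (1 / 2 : ℝ) *
      (∫⁻ ξ, ‖∫ x, Φ x ξ * g x ∂μ‖ₑ ^ (2 : ℝ) ∂ν) ^ (1 / 2 : ℝ) := by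
    refine (enorm_integral_le_lintegral_enorm _).trans ?_
    simp_rw [enorm_mul]
    exact ENNReal.lintegral_mul_le_Lp_mul_Lq ν Real.HolderConjugate.two_two hm.enorm.aemeasurable
      hdual_meas.enorm.aemeasurable
  have hdual := lintegral_enorm_dual_sq_le hΦ hΦ1 hK hg hgD
  simp_rw [g, enorm_dualDensity (show 1 < 2 * q by linarith)] at hdual
  refine le_mul_rpow_of_le_rpow_mul_rpow hq ?_ (hpairing.le.trans (hcauchy.trans ?_))
  · rw [lintegral_enorm_rpow_eq_enorm_integral (by linarith) hint]
    exact enorm_ne_top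
  · gcongr
    exact hdual.trans (lintegral_kernel_mul_mul_le hJ hq hl hr (hF.enorm.pow_const _))

end DualityMethod

section KernelBounds

/-- The frequencies `ℓ < |ξ| ≤ 2ℓ`. -/
def annulus (ℓ : ℝ) : Set ℝ :=
  Set.Icc (-(2 * ℓ)) (2 * ℓ) \ Set.Icc (-ℓ) ℓ

theorem measurableSet_annulus (ℓ : ℝ) : MeasurableSet (annulus ℓ) :=
  measurableSet_Icc.diff measurableSet_Icc

theorem volume_annulus_lt_top (ℓ : ℝ) : volume (annulus ℓ) < ∞ :=
  (measure_mono Set.sdiff_subset).trans_lt measure_Icc_lt_top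

theorem setIntegral_annulus {ℓ : ℝ} (hℓ : 0 ≤ ℓ) {u : ℝ → ℂ}
    (hu : IntegrableOn u (Set.Icc (-(2 * ℓ)) (2 * ℓ))) :
    ∫ ξ in annulus ℓ, u ξ =
      (∫ ξ in Set.Icc (-(2 * ℓ)) (2 * ℓ), u ξ) - ∫ ξ in Set.Icc (-ℓ) ℓ, u ξ :=
  setIntegral_sdiff measurableSet_Icc hu (Set.Icc_subset_Icc (by linarith) (by linarith))

/-- The convolution kernel of `TT*` for the Schrödinger evolution at frequencies in `annulus ℓ`,
as a function of the differences `t` of the times and `y` of the positions. -/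
noncomputable def bandKernel (ℓ t y : ℝ) : ℂ :=
  ∫ ξ in annulus ℓ, phase t y ξ

variable {ℓ t y : ℝ}

theorem norm_bandKernel_le_two_mul {B : ℝ} (hℓ : 0 ≤ ℓ)
    (h : ∀ L, 0 ≤ L → L ≤ 2 * ℓ → ‖∫ ξ in (-L)..L, phase t y ξ‖ ≤ B) :
    ‖bandKernel ℓ t y‖ ≤ 2 * B := by
  rw [bandKernel,
    setIntegral_annulus hℓ (continuous_phase_right t y).continuousOn.integrableOn_Icc,
    integral_Icc_eq_integral_Ioc, integral_Icc_eq_integral_Ioc,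
    ← intervalIntegral.integral_of_le (by linarith),
    ← intervalIntegral.integral_of_le (by linarith), two_mul B]
  exact (norm_sub_le _ _).trans (add_le_add (h (2 * ℓ) (by linarith) le_rfl)
    (h ℓ hℓ (by linarith)))

theorem norm_bandKernel_le_frequency (hℓ : 0 ≤ ℓ) (t y : ℝ) : ‖bandKernel ℓ t y‖ ≤ 8 * ℓ := by
  have := norm_bandKernel_le_two_mul (t := t) (y := y) (B := 4 * ℓ) hℓ fun L hL hL' => by
    refine (norm_integral_phase_le_length t y _ _).trans ?_
    rw [abs_of_nonneg (by linarith)]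
    linarith
  linarith

theorem norm_bandKernel_le_time (hℓ : 0 ≤ ℓ) (ht : t ≠ 0) (y : ℝ) :
    ‖bandKernel ℓ t y‖ ≤ 12 * |t| ^ (-(1 / 2) : ℝ) := by
  have := norm_bandKernel_le_two_mul hℓ fun L hL _ =>
    norm_integral_phase_le_rpow y (by linarith : -L ≤ L) ht
  linarith

theorem norm_bandKernel_le_of_nonstationary (hℓ : 0 ≤ ℓ) (hy : y ≠ 0)
    (hty : 8 * ℓ * |t| ≤ |y|) : ‖bandKernel ℓ t y‖ ≤ 16 / |y| := by
  have hy' : 0 < |y| := abs_pos.2 hy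
  refine (norm_bandKernel_le_two_mul (B := 4 / (|y| / 2)) hℓ fun L hL hL' => ?_).trans_eq
    (by field_simp; norm_num)
  refine norm_integral_phase_le_of_le_deriv (by linarith) (by linarith) fun ξ hξ => ?_
  have hξ' : |2 * t * ξ| ≤ |y| / 2 := by
    rw [abs_mul, abs_mul, abs_two]
    nlinarith [abs_nonneg t, (abs_le.2 hξ).trans hL']
  have := abs_sub_abs_le_abs_sub y (-(2 * t * ξ))
  rw [sub_neg_eq_add, abs_neg] at this
  linarith

/- In the nonstationary case `8ℓ|t| ≤ |y|` this is the geometric mean of the bounds `8ℓ` and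
`16 / |y|`. -/
theorem norm_bandKernel_le_space (hℓ : 0 < ℓ) (t : ℝ) (hy : y ≠ 0) :
    ‖bandKernel ℓ t y‖ ≤ 36 * (ℓ / |y|) ^ (1 / 2 : ℝ) := by
  have hy' : 0 < |y| := abs_pos.2 hy
  rw [← Real.sqrt_eq_rpow]
  refine abs_le_of_sq_le_sq' ?_ (by positivity) |>.2
  rw [mul_pow, Real.sq_sqrt (by positivity), mul_div_assoc', le_div_iff₀ hy']
  rcases le_total (8 * ℓ * |t|) |y| with hty | hty
  · have hfreq := norm_bandKernel_le_frequency hℓ.le t y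
    have hspace := norm_bandKernel_le_of_nonstationary hℓ.le hy hty
    rw [le_div_iff₀ hy'] at hspace
    nlinarith [mul_le_mul hfreq hspace (by positivity) (by positivity)]
  · have ht : t ≠ 0 := by
      rintro rfl
      rw [abs_zero, mul_zero] at hty
      linarith
    have htime := norm_bandKernel_le_time hℓ.le ht y
    rw [Real.rpow_neg (abs_nonneg t), ← Real.sqrt_eq_rpow, ← div_eq_mul_inv,
      le_div_iff₀ (Real.sqrt_pos.2 (abs_pos.2 ht))] at htime
    have hsq := pow_le_pow_left₀ (by positivity) htime 2
    rw [mul_pow, Real.sq_sqrt (abs_nonneg t)] at hsq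
    nlinarith [mul_le_mul_of_nonneg_left hty (sq_nonneg ‖bandKernel ℓ t y‖)]

theorem le_mul_rpow_mul_rpow {V M u v τ : ℝ} (hV : 0 ≤ V) (hM : 0 ≤ M) (hu : 0 ≤ u) (hv : 0 ≤ v)
    (hτ : τ ∈ Set.Icc (0 : ℝ) 1) (hVu : V ≤ M * u) (hVv : V ≤ M * v) :
    V ≤ M * (u ^ (1 - τ) * v ^ τ) := by
  have h0 : 0 ≤ τ := hτ.1
  have h1 : 0 ≤ 1 - τ := sub_nonneg.2 hτ.2
  calc V = V ^ (1 - τ) * V ^ τ := by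
        rw [← Real.rpow_add' hV (by norm_num), sub_add_cancel, Real.rpow_one]
    _ ≤ (M * u) ^ (1 - τ) * (M * v) ^ τ := by gcongr
    _ = M ^ (1 - τ) * M ^ τ * (u ^ (1 - τ) * v ^ τ) := by
        rw [Real.mul_rpow hM hu, Real.mul_rpow hM hv]
        ring
    _ = M * (u ^ (1 - τ) * v ^ τ) := by
        rw [← Real.rpow_add' hM (by norm_num), sub_add_cancel, Real.rpow_one]

theorem le_mul_rpow_of_le_mul {V M w c d e ρ τ : ℝ} (hV : 0 ≤ V) (hM : 0 ≤ M) (hℓ : 0 < ℓ)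
    (hw : 0 < w) (hρ : 0 ≤ ρ) (hτ : τ ∈ Set.Icc (0 : ℝ) 1) (hc : 0 < c) (hd : 0 < d)
    (hdw : d ≤ c * w) (hVℓ : V ≤ M * ℓ) (hVw : V ≤ M * (ℓ ^ e * w ^ (-ρ))) :
    V ≤ M * c ^ (ρ * τ) * ℓ ^ (1 - τ + e * τ) * d ^ (-(ρ * τ)) := by
  have hρτ : 0 ≤ ρ * τ := mul_nonneg hρ hτ.1
  calc V ≤ M * (ℓ ^ (1 - τ) * (ℓ ^ e * w ^ (-ρ)) ^ τ) :=
        le_mul_rpow_mul_rpow hV hM hℓ.le (by positivity) hτ hVℓ hVw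
    _ = M * (ℓ ^ (1 - τ + e * τ) * w ^ (-(ρ * τ))) := by
        rw [Real.mul_rpow (by positivity) (by positivity), ← Real.rpow_mul hℓ.le,
          ← Real.rpow_mul hw.le, ← mul_assoc (ℓ ^ (1 - τ)), ← Real.rpow_add hℓ, neg_mul]
    _ ≤ M * (ℓ ^ (1 - τ + e * τ) * (d / c) ^ (-(ρ * τ))) := by
        have : (w : ℝ) ^ (-(ρ * τ)) ≤ (d / c) ^ (-(ρ * τ)) :=
          Real.rpow_le_rpow_of_nonpos (by positivity) ((div_le_iff₀' hc).2 hdw) (by linarith)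
        gcongr
    _ = M * c ^ (ρ * τ) * ℓ ^ (1 - τ + e * τ) * d ^ (-(ρ * τ)) := by
        rw [Real.div_rpow hd.le hc.le, Real.rpow_neg hc.le, div_inv_eq_mul]
        ring

theorem norm_bandKernel_le_of_le_space {c d R κ e : ℝ} (hc : 0 < c) (hd : 0 < d) (hdR : d ≤ R)
    (hκ : 0 ≤ κ) (heκ : e ≤ κ) (he : e ≤ 1 / 2) (hℓ : 1 ≤ ℓ) (hdy : d ≤ c * |y|) :
    ‖bandKernel ℓ t y‖ ≤
      36 * c ^ min κ (1 / 2) * R ^ (κ - min κ (1 / 2)) * ℓ ^ (1 - e) * d ^ (-κ) := by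
  have hℓ0 : 0 < ℓ := one_pos.trans_le hℓ
  set κ₀ := min κ (1 / 2)
  have hκ₀ : 0 ≤ κ₀ := le_min hκ (by norm_num)
  have hκ₀' : κ₀ ≤ 1 / 2 := min_le_right _ _
  have hy : 0 < |y| := pos_of_mul_pos_right (hd.trans_le hdy) hc.le
  have hspace := norm_bandKernel_le_space hℓ0 t (abs_pos.1 hy)
  rw [Real.div_rpow hℓ0.le hy.le, div_eq_mul_inv, ← Real.rpow_neg hy.le] at hspace
  have hbound := le_mul_rpow_of_le_mul (τ := 2 * κ₀) (norm_nonneg _) (by norm_num) hℓ0 hy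
    (by norm_num) ⟨by linarith, by linarith⟩ hc hd hdy
    ((norm_bandKernel_le_frequency hℓ0.le t y).trans (by linarith)) hspace
  have e₁ : (1 / 2 : ℝ) * (2 * κ₀) = κ₀ := by ring
  have e₂ : 1 - 2 * κ₀ + κ₀ = 1 - κ₀ := by ring
  rw [e₁, e₂] at hbound
  have hκκ₀ : 0 ≤ κ - κ₀ := sub_nonneg.2 (min_le_left _ _)
  calc _ ≤ 36 * c ^ κ₀ * ℓ ^ (1 - κ₀) * d ^ (-κ₀) := hbound
    _ = 36 * c ^ κ₀ * d ^ (κ - κ₀) * ℓ ^ (1 - κ₀) * d ^ (-κ) := by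
        have : -κ₀ = κ - κ₀ + -κ := by ring
        rw [this, Real.rpow_add hd]
        ring
    _ ≤ _ := by
        have : 1 - κ₀ ≤ 1 - e := sub_le_sub_left (le_min heκ he) 1
        have hR : 0 < R := hd.trans_le hdR
        gcongr

theorem norm_bandKernel_le_of_le_time {α κ c d w : ℝ} (hα : 0 < α) (hκ : 0 ≤ κ)
    (hακ : 2 * α * κ ≤ 1) (hc : 0 < c) (hd : 0 < d) (hw : 0 < w) (hℓ : 0 < ℓ)
    (hdw : d ≤ c * w) (h : ‖bandKernel ℓ t y‖ ≤ 36 * w ^ (-(1 / (2 * α)))) :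
    ‖bandKernel ℓ t y‖ ≤ 36 * c ^ κ * ℓ ^ (1 - 2 * α * κ) * d ^ (-κ) := by
  have hbound := le_mul_rpow_of_le_mul (M := 36) (ρ := 1 / (2 * α)) (e := 0) (τ := 2 * α * κ)
    (norm_nonneg _) (by norm_num) hℓ hw (by positivity) ⟨by positivity, hακ⟩ hc hd hdw
    ((norm_bandKernel_le_frequency hℓ.le t y).trans (by linarith))
    (by rwa [Real.rpow_zero, one_mul])
  have e₁ : 1 / (2 * α) * (2 * α * κ) = κ := by field_simp
  rwa [e₁, zero_mul, add_zero] at hbound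

theorem le_three_mul_of_le_add {C₁ C₂ C₃ d a b c : ℝ} (hC₁ : 0 ≤ C₁) (hC₂ : 0 ≤ C₂) (hC₃ : 0 ≤ C₃)
    (ha : 0 ≤ a) (h : d ≤ C₁ * (a + C₂ * b + C₃ * c)) :
    d ≤ 3 * C₁ * (1 + C₂ + C₃) * a ∨ d ≤ 3 * C₁ * (1 + C₂ + C₃) * b ∨
      d ≤ 3 * C₁ * (1 + C₂ + C₃) * c := by
  have hmax : a + C₂ * b + C₃ * c ≤ (1 + C₂ + C₃) * max a (max b c) := by
    nlinarith [le_max_left a (max b c), (le_max_left b c).trans (le_max_right a (max b c)),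
      (le_max_right b c).trans (le_max_right a (max b c))]
  have hle : d ≤ 3 * C₁ * (1 + C₂ + C₃) * max a (max b c) := by
    have hm : 0 ≤ max a (max b c) := ha.trans (le_max_left _ _)
    nlinarith [mul_le_mul_of_nonneg_left hmax hC₁, mul_nonneg hC₁ (mul_nonneg
      (by linarith : 0 ≤ 1 + C₂ + C₃) hm)]
  grind

theorem exists_norm_bandKernel_le {α κ C₁ C₂ C₃ R : ℝ} (hα : 0 < α) (hα2 : 2 * α ≤ 1)
    (hκ : 0 ≤ κ) (hακ : 4 * α * κ ≤ 1) (hC₁ : 0 < C₁) (hC₂ : 0 ≤ C₂) (hC₃ : 0 ≤ C₃) (hR : 0 < R) :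
    ∃ C : ℝ, 0 < C ∧ ∀ ℓ d t y : ℝ, 1 ≤ ℓ → 0 < d → d ≤ R →
      d ≤ C₁ * (|y| + C₂ * |t| ^ α + C₃ * ℓ ^ (-(2 * α))) →
      ‖bandKernel ℓ t y‖ ≤ C * ℓ ^ (1 - 2 * α * κ) * d ^ (-κ) := by
  set c := 3 * C₁ * (1 + C₂ + C₃)
  have hc : 0 < c := by positivity
  set Cy : ℝ := 36 * c ^ min κ (1 / 2) * R ^ (κ - min κ (1 / 2))
  set Ct : ℝ := 36 * c ^ κ
  have hα' : -(2 * α) * -(1 / (2 * α)) = 1 := by field_simp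
  refine ⟨Cy + Ct, by positivity, fun ℓ d t y hℓ hd hdR hle => ?_⟩
  have hℓ0 : 0 < ℓ := one_pos.trans_le hℓ
  have hmono : ∀ C', C' ≤ Cy + Ct →
      ‖bandKernel ℓ t y‖ ≤ C' * ℓ ^ (1 - 2 * α * κ) * d ^ (-κ) →
      ‖bandKernel ℓ t y‖ ≤ (Cy + Ct) * ℓ ^ (1 - 2 * α * κ) * d ^ (-κ) := fun C' hC' h =>
    h.trans (by gcongr)
  rcases le_three_mul_of_le_add hC₁.le hC₂ hC₃ (abs_nonneg y) hle
    with hy | ht | hfreq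
  · refine hmono Cy (le_add_of_nonneg_right (by positivity)) ?_
    exact norm_bandKernel_le_of_le_space hc hd hdR hκ (by nlinarith) (by linarith) hℓ hy
  · refine hmono Ct (le_add_of_nonneg_left (by positivity)) ?_
    have hw : 0 < |t| ^ α := pos_of_mul_pos_right (hd.trans_le ht) hc.le
    have ht0 : t ≠ 0 := by
      rintro rfl
      simp [Real.zero_rpow hα.ne'] at hw
    refine norm_bandKernel_le_of_le_time hα hκ (by nlinarith) hc hd hw hℓ0 ht
      ((norm_bandKernel_le_time hℓ0.le ht0 y).trans ?_)
    have e₁ : α * -(1 / (2 * α)) = -(1 / 2) := by field_simp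
    rw [← Real.rpow_mul (abs_nonneg t), e₁]
    gcongr
    norm_num
  · refine hmono Ct (le_add_of_nonneg_left (by positivity)) ?_
    refine norm_bandKernel_le_of_le_time hα hκ (by nlinarith) hc hd (by positivity) hℓ0 hfreq
      ((norm_bandKernel_le_frequency hℓ0.le t y).trans ?_)
    rw [← Real.rpow_mul hℓ0.le, hα', Real.rpow_one]
    linarith

theorem setLIntegral_Ioc_enorm_rpow_lt_top {p : ℝ} (hp : -1 < p) (a b : ℝ) :
    ∫⁻ z in Set.Ioc a b, ‖z‖ₑ ^ p < ∞ := by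
  have hint : IntervalIntegrable (fun z : ℝ => (z : ℂ) ^ (p : ℂ)) volume a b :=
    intervalIntegral.intervalIntegrable_cpow' (by simpa using hp)
  refine lt_of_le_of_lt (le_of_eq (lintegral_congr_ae ?_)) hint.1.2
  filter_upwards [ae_restrict_of_ae (Measure.ae_ne volume (0 : ℝ))] with z hz
  rw [← ofReal_norm, ← ofReal_norm, Complex.norm_cpow_real, Complex.norm_real,
    ENNReal.ofReal_rpow_of_pos (norm_pos_iff.2 hz)]

theorem exists_setLIntegral_enorm_sub_rpow_le {p : ℝ} (hp : -1 < p) (hp0 : p < 0) {s : Set ℝ}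
    (hs : volume s ≠ ∞) : ∃ A : ℝ≥0, ∀ x : ℝ, ∫⁻ x' in s, ‖x - x'‖ₑ ^ p ≤ A := by
  set G : ℝ → ℝ≥0∞ := (Set.Ioc (-1 : ℝ) 1).indicator fun z => ‖z‖ₑ ^ p with hG
  have hGtop : ∫⁻ z, G z ≠ ∞ := by
    rw [hG, lintegral_indicator measurableSet_Ioc]
    exact (setLIntegral_Ioc_enorm_rpow_lt_top hp _ _).ne
  have hle : ∀ z : ℝ, ‖z‖ₑ ^ p ≤ G z + 1 := fun z => by
    by_cases hz : z ∈ Set.Ioc (-1 : ℝ) 1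
    · rw [hG, Set.indicator_of_mem hz]
      exact le_self_add
    · refine le_add_left (ENNReal.rpow_le_one_of_one_le_of_neg ?_ hp0)
      rw [← ofReal_norm, Real.norm_eq_abs, ENNReal.one_le_ofReal]
      by_contra h
      exact hz (Set.Ioo_subset_Ioc_self (abs_lt.1 (not_le.1 h)))
  refine ⟨((∫⁻ z, G z) + volume s).toNNReal, fun x => ?_⟩
  rw [ENNReal.coe_toNNReal (ENNReal.add_ne_top.2 ⟨hGtop, hs⟩)]
  calc ∫⁻ x' in s, ‖x - x'‖ₑ ^ p
      ≤ ∫⁻ x' in s, (G (x - x') + 1) := lintegral_mono fun x' => hle _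
    _ = (∫⁻ x' in s, G (x - x')) + volume s := by
        rw [lintegral_add_right _ measurable_const, setLIntegral_one]
    _ ≤ (∫⁻ x', G (x - x')) + volume s := by
        gcongr
        exact Measure.restrict_le_self
    _ = (∫⁻ z, G z) + volume s := by rw [lintegral_sub_left_eq_self (fun z => G z) x]

end KernelBounds

section Curves

variable {Θ Θ' : Set ℝ} {α C₁ C₂ C₃ : ℝ} {γ : ℝ → ℝ → ℝ → ℝ}

namespace IsCurveFamily

theorem mono (hγ : IsCurveFamily Θ α C₁ C₂ C₃ γ) (h : Θ' ⊆ Θ) : IsCurveFamily Θ' α C₁ C₂ C₃ γ where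
  initial x θ hθ := hγ.initial x θ (h hθ)
  contDiff t ht θ hθ := hγ.contDiff t ht θ (h hθ)
  bilipschitz x x' t ht θ hθ := hγ.bilipschitz x x' t ht θ (h hθ)
  holder x t ht t' ht' θ hθ := hγ.holder x t ht t' ht' θ (h hθ)
  lipschitz x t ht θ hθ θ' hθ' := hγ.lipschitz x t ht θ (h hθ) θ' (h hθ')

theorem mono_holder (hγ : IsCurveFamily Θ α C₁ C₂ C₃ γ) {α' : ℝ} (hα' : 0 ≤ α') (h : α' ≤ α)
    (hC₂ : 0 ≤ C₂) : IsCurveFamily Θ α' C₁ C₂ C₃ γ where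
  __ := hγ
  holder x t ht t' ht' θ hθ := (hγ.holder x t ht t' ht' θ hθ).trans <|
    mul_le_mul_of_nonneg_left (Real.rpow_le_rpow_of_exponent_ge' (abs_nonneg _)
      (abs_le.2 ⟨by linarith [ht.1, ht'.2], by linarith [ht.2, ht'.1]⟩) hα' h) hC₂

theorem abs_sub_le_mul (hγ : IsCurveFamily Θ α C₁ C₂ C₃ γ) (hC₁ : 0 < C₁) (x x' : ℝ)
    {t t' θ θ' : ℝ} (ht : t ∈ Set.Icc (0 : ℝ) 1) (ht' : t' ∈ Set.Icc (0 : ℝ) 1) (hθ : θ ∈ Θ)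
    (hθ' : θ' ∈ Θ) :
    |x - x'| ≤ C₁ * (|γ x t θ - γ x' t' θ'| + C₂ * |t - t'| ^ α + C₃ * |θ - θ'|) := by
  rw [← inv_mul_le_iff₀ hC₁]
  have hspace := (hγ.bilipschitz x x' t ht θ hθ).1
  have htime := hγ.holder x' t ht t' ht' θ hθ
  have hparam := hγ.lipschitz x' t' ht' θ hθ θ' hθ'
  rw [abs_sub_comm] at htime hparam
  linarith [abs_sub_le (γ x t θ) (γ x' t' θ) (γ x' t θ),
    abs_sub_le (γ x t θ) (γ x' t' θ') (γ x' t' θ)]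

theorem continuous_space (hγ : IsCurveFamily Θ α C₁ C₂ C₃ γ) {t θ : ℝ}
    (ht : t ∈ Set.Icc (0 : ℝ) 1) (hθ : θ ∈ Θ) : Continuous fun x => γ x t θ :=
  (hγ.contDiff t ht θ hθ).continuous

theorem continuousOn_time_parameter (hγ : IsCurveFamily Θ α C₁ C₂ C₃ γ) (hα : 0 < α) (x : ℝ) :
    ContinuousOn (fun z : ℝ × ℝ => γ x z.1 z.2) (Set.Icc (0 : ℝ) 1 ×ˢ Θ) := by
  rintro ⟨t₀, θ₀⟩ ⟨ht₀, hθ₀⟩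
  rw [ContinuousWithinAt, tendsto_iff_dist_tendsto_zero]
  have hbound : Continuous fun z : ℝ × ℝ => C₂ * |z.1 - t₀| ^ α + C₃ * |z.2 - θ₀| :=
    ((Continuous.rpow_const (by fun_prop) fun _ => Or.inr hα.le).const_mul C₂).add (by fun_prop)
  have hlim : Tendsto (fun z : ℝ × ℝ => C₂ * |z.1 - t₀| ^ α + C₃ * |z.2 - θ₀|)
      (𝓝[Set.Icc (0 : ℝ) 1 ×ˢ Θ] (t₀, θ₀)) (𝓝 0) := by
    simpa [Real.zero_rpow hα.ne'] using
      (hbound.tendsto (t₀, θ₀)).mono_left (nhdsWithin_le_nhds (s := Set.Icc (0 : ℝ) 1 ×ˢ Θ))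
  refine squeeze_zero' (Eventually.of_forall fun _ => dist_nonneg) ?_ hlim
  filter_upwards [self_mem_nhdsWithin] with z hz
  rw [Real.dist_eq]
  linarith [hγ.holder x z.1 hz.1 t₀ ht₀ z.2 hz.2, hγ.lipschitz x t₀ ht₀ z.2 hz.2 θ₀ hθ₀,
    abs_sub_le (γ x z.1 z.2) (γ x t₀ z.2) (γ x t₀ θ₀)]

end IsCurveFamily

/-- The supremum of `|u(t, y)|` over the points `(t, γ(x,t,θ))`, `t ∈ (0,1)`, `θ ∈ Θ`; for
`u = schrodinger f` it is `maximalFunction Θ γ f x`. -/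
noncomputable def supAlong (Θ : Set ℝ) (γ : ℝ → ℝ → ℝ → ℝ) (u : ℝ → ℝ → ℂ) (x : ℝ) : ℝ≥0∞ :=
  ⨆ t ∈ Set.Ioo (0 : ℝ) 1, ⨆ θ ∈ Θ, ‖u t (γ x t θ)‖ₑ

variable {u : ℝ → ℝ → ℂ}

theorem le_supAlong (γ : ℝ → ℝ → ℝ → ℝ) (u : ℝ → ℝ → ℂ) (x : ℝ) {t θ : ℝ}
    (ht : t ∈ Set.Ioo (0 : ℝ) 1) (hθ : θ ∈ Θ) : ‖u t (γ x t θ)‖ₑ ≤ supAlong Θ γ u x :=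
  le_iSup₂_of_le t ht (le_iSup₂_of_le θ hθ le_rfl)

theorem supAlong_le {x : ℝ} {B : ℝ≥0∞}
    (h : ∀ t ∈ Set.Ioo (0 : ℝ) 1, ∀ θ ∈ Θ, ‖u t (γ x t θ)‖ₑ ≤ B) : supAlong Θ γ u x ≤ B :=
  iSup₂_le fun t ht => iSup₂_le fun θ hθ => h t ht θ hθ

theorem measurable_supAlong (hγ : IsCurveFamily Θ α C₁ C₂ C₃ γ) (hu : ∀ t, Continuous (u t)) :
    Measurable (supAlong Θ γ u) := by
  refine LowerSemicontinuous.measurable (lowerSemicontinuous_biSup fun t ht =>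
    lowerSemicontinuous_biSup fun θ hθ => Continuous.lowerSemicontinuous ?_)
  exact continuous_enorm.comp ((hu t).comp (hγ.continuous_space (Set.Ioo_subset_Icc_self ht) hθ))

theorem exists_measurable_selection {S X : Type*} [TopologicalSpace S]
    [TopologicalSpace.SeparableSpace S] [Nonempty S] [MeasurableSpace X] {F : S → X → ℝ≥0∞}
    (hF : ∀ s, Measurable (F s)) (hFc : ∀ x, Continuous fun s => F s x)
    (htop : ∀ x, ⨆ s, F s x ≠ ∞) :
    ∃ n : X → ℕ, Measurable n ∧
      ∀ x, ⨆ s, F s x ≤ 2 * F (TopologicalSpace.denseSeq S (n x)) x := by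
  classical
  have hdense : ∀ x, ⨆ n, F (TopologicalSpace.denseSeq S n) x = ⨆ s, F s x := fun x => by
    rw [← (TopologicalSpace.denseRange_denseSeq S).ciSup' (hFc x)]
    exact (iSup_range' (fun s => F s x) _).symm
  have hM : Measurable fun x => ⨆ s, F s x := by
    simp_rw [← hdense]
    exact Measurable.iSup fun n => hF _
  have hexists : ∀ x, ∃ n, ⨆ s, F s x ≤ 2 * F (TopologicalSpace.denseSeq S n) x := fun x => by
    rcases eq_or_ne (⨆ s, F s x) 0 with h0 | h0
    · exact ⟨0, h0.trans_le zero_le⟩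
    · have hlt := ENNReal.half_lt_self h0 (htop x)
      nth_rw 2 [← hdense] at hlt
      obtain ⟨n, hn⟩ := lt_iSup_iff.1 hlt
      refine ⟨n, ?_⟩
      rw [mul_comm]
      exact (ENNReal.div_le_iff two_ne_zero ENNReal.ofNat_ne_top).1 hn.le
  refine ⟨fun x => Nat.find (hexists x), measurable_find hexists fun n => ?_,
    fun x => Nat.find_spec (hexists x)⟩
  exact measurableSet_le hM ((hF _).const_mul 2)

theorem exists_measurable_selection_supAlong (hγ : IsCurveFamily Θ α C₁ C₂ C₃ γ) (hα : 0 < α)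
    (hΘ : Θ.Nonempty) (hu : Continuous (Function.uncurry u)) (htop : ∀ x, supAlong Θ γ u x ≠ ∞) :
    ∃ τ ϑ : ℝ → ℝ, Measurable τ ∧ (Measurable fun x => γ x (τ x) (ϑ x)) ∧
      (∀ x, τ x ∈ Set.Ioo (0 : ℝ) 1) ∧ (∀ x, ϑ x ∈ Θ) ∧
      ∀ x, supAlong Θ γ u x ≤ 2 * ‖u (τ x) (γ x (τ x) (ϑ x))‖ₑ := by
  let S : Type := ↥(Set.Ioo (0 : ℝ) 1 ×ˢ Θ)
  have : Nonempty S := ((Set.nonempty_Ioo.2 one_pos).prod hΘ).to_subtype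
  have hspace : ∀ s : S, Measurable fun x => γ x s.1.1 s.1.2 := fun s =>
    (hγ.continuous_space (Set.Ioo_subset_Icc_self s.2.1) s.2.2).measurable
  have hcurve : ∀ x, Continuous fun s : S => γ x s.1.1 s.1.2 := fun x =>
    (hγ.continuousOn_time_parameter hα x).comp_continuous continuous_subtype_val
      fun s => ⟨Set.Ioo_subset_Icc_self s.2.1, s.2.2⟩
  let F : S → ℝ → ℝ≥0∞ := fun s x => ‖u s.1.1 (γ x s.1.1 s.1.2)‖ₑ
  have hsup : ∀ x, ⨆ s, F s x = supAlong Θ γ u x := fun x =>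
    le_antisymm (iSup_le fun s => le_supAlong γ u x s.2.1 s.2.2)
      (supAlong_le fun t ht θ hθ => le_iSup (fun s => F s x) ⟨(t, θ), ht, hθ⟩)
  obtain ⟨n, hn, hsel⟩ := exists_measurable_selection (F := F)
    (fun s => (hu.measurable.comp (measurable_const.prodMk (hspace s))).enorm)
    (fun x => continuous_enorm.comp
      (hu.comp ((continuous_fst.comp continuous_subtype_val).prodMk (hcurve x))))
    fun x => (hsup x).trans_ne (htop x)
  set e := TopologicalSpace.denseSeq S
  refine ⟨fun x => (e (n x)).1.1, fun x => (e (n x)).1.2,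
    (measurable_from_nat (f := fun k => (e k).1.1)).comp hn, ?_, fun x => (e (n x)).2.1,
    fun x => (e (n x)).2.2, fun x => (hsup x).symm.trans_le (hsel x)⟩
  exact (measurable_from_prod_countable_left (f := fun z : ℝ × ℕ => γ z.1 (e z.2).1.1 (e z.2).1.2)
    fun k => hspace (e k)).comp (measurable_id.prodMk hn)

end Curves

section FrequencyBand

variable {α C₁ C₂ C₃ κ q : ℝ} {E : Set ℝ} {h : ℝ → ℂ}

/-- The part of `∫ e^{i(yξ + tξ²)} h(ξ) dξ` from frequencies in `E`. -/
noncomputable def bandIntegral (E : Set ℝ) (h : ℝ → ℂ) (t y : ℝ) : ℂ :=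
  ∫ ξ in E, phase t y ξ * h ξ

theorem enorm_bandIntegral_le (E : Set ℝ) (h : ℝ → ℂ) (t y : ℝ) :
    ‖bandIntegral E h t y‖ₑ ≤ ∫⁻ ξ in E, ‖h ξ‖ₑ := by
  refine (enorm_integral_le_lintegral_enorm _).trans (le_of_eq (lintegral_congr fun ξ => ?_))
  rw [enorm_mul, ← ofReal_norm (phase t y ξ), norm_phase, ENNReal.ofReal_one, one_mul]

theorem continuous_bandIntegral (hh : IntegrableOn h E) :
    Continuous (Function.uncurry (bandIntegral E h)) := by
  refine continuous_of_dominated (bound := fun ξ => ‖h ξ‖) (fun z => ?_) (fun z => ?_) hh.norm ?_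
  · exact (continuous_phase_right z.1 z.2).aestronglyMeasurable.mul hh.aestronglyMeasurable
  · refine ae_of_all _ fun ξ => ?_
    rw [norm_mul, norm_phase, one_mul]
  · refine ae_of_all _ fun ξ => ?_
    exact (continuous_phase.comp (by fun_prop : Continuous fun z : ℝ × ℝ => (z.1, z.2, ξ))).mul
      continuous_const

theorem exists_enorm_bandKernel_along_le (Θ : Set ℝ) (hα : 0 < α) (hα2 : 2 * α ≤ 1) (hκ : 0 < κ)
    (hακ : 4 * α * κ ≤ 1) (hC₁ : 0 < C₁) (hC₂ : 0 ≤ C₂) (hC₃ : 0 ≤ C₃) (R : ℝ) :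
    ∃ C : ℝ≥0, ∀ γ, IsCurveFamily Θ α C₁ C₂ C₃ γ → ∀ ℓ : ℝ, 1 ≤ ℓ → ∀ x x' : ℝ, |x - x'| ≤ R →
      ∀ t ∈ Set.Icc (0 : ℝ) 1, ∀ t' ∈ Set.Icc (0 : ℝ) 1, ∀ θ ∈ Θ, ∀ θ' ∈ Θ,
      |θ - θ'| ≤ ℓ ^ (-(2 * α)) →
      ‖bandKernel ℓ (t - t') (γ x t θ - γ x' t' θ')‖ₑ ≤
        C * ENNReal.ofReal (ℓ ^ (1 - 2 * α * κ)) * ‖x - x'‖ₑ ^ (-κ) := by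
  obtain ⟨C, hC0, hC⟩ := exists_norm_bandKernel_le hα hα2 hκ.le hακ hC₁ hC₂ hC₃
    (lt_max_of_lt_right one_pos : 0 < max R 1)
  refine ⟨C.toNNReal, fun γ hγ ℓ hℓ x x' hR t ht t' ht' θ hθ θ' hθ' hθθ' => ?_⟩
  have hℓ0 : 0 < ℓ := one_pos.trans_le hℓ
  change _ ≤ ENNReal.ofReal C * _ * _
  rw [← ENNReal.ofReal_mul hC0.le]
  rcases eq_or_ne x x' with rfl | hne
  · rw [sub_self x, enorm_zero, ENNReal.zero_rpow_of_neg (neg_neg_of_pos hκ),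
      ENNReal.mul_top (ENNReal.ofReal_pos.2 (mul_pos hC0 (Real.rpow_pos_of_pos hℓ0 _))).ne']
    exact le_top
  · have hd : 0 < |x - x'| := abs_pos.2 (sub_ne_zero.2 hne)
    have hdist := hγ.abs_sub_le_mul hC₁ x x' ht ht' hθ hθ'
    rw [← ofReal_norm, ← ofReal_norm (x - x'), Real.norm_eq_abs, ENNReal.ofReal_rpow_of_pos hd,
      ← ENNReal.ofReal_mul (by positivity)]
    refine ENNReal.ofReal_le_ofReal
      (hC ℓ _ _ _ hℓ hd (hR.trans (le_max_left _ _)) (hdist.trans ?_))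
    gcongr

theorem lintegral_enorm_bandIntegral_rpow_le {s : Set ℝ} (hs : MeasurableSet s)
    (hs' : volume s ≠ ∞) {ℓ : ℝ} {τ y : ℝ → ℝ} (hτ : Measurable τ) (hy : Measurable y) {D A : ℝ≥0∞}
    (hD : ∀ x ∈ s, ∀ x' ∈ s, ‖bandKernel ℓ (τ x - τ x') (y x - y x')‖ₑ ≤ D * ‖x - x'‖ₑ ^ (-κ))
    (hq : 1 ≤ q) (hA : ∀ x, ∫⁻ x' in s, ‖x - x'‖ₑ ^ (-(κ * q)) ≤ A) (hm : Measurable h)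
    (hh : IntegrableOn h (annulus ℓ)) :
    ∫⁻ x in s, ‖bandIntegral (annulus ℓ) h (τ x) (y x)‖ₑ ^ (2 * q) ≤
      D ^ q * A * (∫⁻ ξ in annulus ℓ, ‖h ξ‖ₑ ^ (2 : ℝ)) ^ q := by
  have : IsFiniteMeasure (volume.restrict (annulus ℓ)) :=
    isFiniteMeasure_restrict.2 (volume_annulus_lt_top ℓ).ne
  have : IsFiniteMeasure (volume.restrict s) := isFiniteMeasure_restrict.2 hs'
  have hJ : ∀ x, ∫⁻ x' in s, (D * ‖x - x'‖ₑ ^ (-κ)) ^ q ≤ D ^ q * A := fun x => by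
    simp_rw [ENNReal.mul_rpow_of_nonneg _ _ (zero_le_one.trans hq), ← ENNReal.rpow_mul, neg_mul]
    rw [lintegral_const_mul _ (by fun_prop)]
    gcongr
    exact hA x
  refine lintegral_enorm_rpow_le_of_kernel_le (Φ := fun x ξ => phase (τ x) (y x) ξ)
    (J := fun x x' => D * ‖x - x'‖ₑ ^ (-κ)) ?_ (fun x ξ => (norm_phase _ _ _).le)
    (by simp only [Function.uncurry_def]; fun_prop) ?_ hq hJ
    (fun x' => by simp_rw [enorm_sub_rev _ x']; exact hJ x') hm hh
  · exact continuous_phase.measurable.comp ((hτ.comp measurable_fst).prodMk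
      ((hy.comp measurable_fst).prodMk measurable_snd))
  · rw [Measure.prod_restrict]
    filter_upwards [ae_restrict_mem (hs.prod hs)] with z hz
    simp_rw [phase_mul_conj]
    exact hD _ hz.1 _ hz.2

theorem exists_lintegral_supAlong_rpow_le_of_diam_le (Θ : Set ℝ) (hα : 0 < α) (hα2 : 2 * α ≤ 1)
    (hκ : 0 < κ) (hακ : 4 * α * κ ≤ 1) (hC₁ : 0 < C₁) (hC₂ : 0 ≤ C₂) (hC₃ : 0 ≤ C₃) (hq : 1 ≤ q)
    (hκq : κ * q < 1) (x₀ r : ℝ) :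
    ∃ C : ℝ≥0, ∀ γ, IsCurveFamily Θ α C₁ C₂ C₃ γ → ∀ h : ℝ → ℂ, Measurable h →
      ∀ ℓ : ℝ, 1 ≤ ℓ → IntegrableOn h (annulus ℓ) → ∀ Θ' ⊆ Θ,
      (∀ θ ∈ Θ', ∀ θ' ∈ Θ', |θ - θ'| ≤ ℓ ^ (-(2 * α))) →
      ∫⁻ x in Metric.ball x₀ r, supAlong Θ' γ (bandIntegral (annulus ℓ) h) x ^ (2 * q) ≤
        C * ENNReal.ofReal (ℓ ^ (1 - 2 * α * κ)) ^ q *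
          (∫⁻ ξ in annulus ℓ, ‖h ξ‖ₑ ^ (2 : ℝ)) ^ q := by
  have hq0 : 0 < q := one_pos.trans_le hq
  obtain ⟨C, hC⟩ := exists_enorm_bandKernel_along_le Θ hα hα2 hκ hακ hC₁ hC₂ hC₃ (2 * r)
  obtain ⟨A, hA⟩ := exists_setLIntegral_enorm_sub_rpow_le (neg_lt_neg hκq)
    (neg_neg_of_pos (mul_pos hκ hq0)) (measure_ball_lt_top (x := x₀) (r := r)).ne
  refine ⟨2 ^ (2 * q) * (C ^ q * A), fun γ hγ h hm ℓ hℓ hh Θ' hΘ' hdiam => ?_⟩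
  rcases Set.eq_empty_or_nonempty Θ' with rfl | hΘ'_nonempty
  · simp [supAlong, hq0]
  obtain ⟨τ, ϑ, hτ, hy, hτ_mem, hϑ_mem, hsel⟩ :=
    exists_measurable_selection_supAlong (hγ.mono hΘ') hα hΘ'_nonempty (continuous_bandIntegral hh)
      fun x => ne_top_of_le_ne_top hh.2.ne
        (supAlong_le fun t _ θ _ => enorm_bandIntegral_le _ h t (γ x t θ))
  have hselected := lintegral_enorm_bandIntegral_rpow_le measurableSet_ball
    (measure_ball_lt_top (x := x₀) (r := r)).ne hτ hy
    (fun x hx x' hx' => hC γ hγ ℓ hℓ x x' (by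
        have := dist_triangle_right x x' x₀
        rw [← Real.dist_eq]
        linarith [Metric.mem_ball.1 hx, Metric.mem_ball.1 hx'])
      _ (Set.Ioo_subset_Icc_self (hτ_mem x)) _ (Set.Ioo_subset_Icc_self (hτ_mem x'))
      _ (hΘ' (hϑ_mem x)) _ (hΘ' (hϑ_mem x')) (hdiam _ (hϑ_mem x) _ (hϑ_mem x'))) hq hA hm hh
  calc _ ≤ ∫⁻ x in Metric.ball x₀ r, 2 ^ (2 * q) *
        ‖bandIntegral (annulus ℓ) h (τ x) (γ x (τ x) (ϑ x))‖ₑ ^ (2 * q) := by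
        refine lintegral_mono fun x => ?_
        rw [← ENNReal.mul_rpow_of_nonneg _ _ (by positivity)]
        exact ENNReal.rpow_le_rpow (hsel x) (by positivity)
    _ = 2 ^ (2 * q) * ∫⁻ x in Metric.ball x₀ r,
        ‖bandIntegral (annulus ℓ) h (τ x) (γ x (τ x) (ϑ x))‖ₑ ^ (2 * q) :=
        lintegral_const_mul' _ _ (ENNReal.rpow_ne_top_of_nonneg (by positivity) (by norm_num))
    _ ≤ _ := mul_le_mul_right hselected _
    _ = _ := by
        rw [ENNReal.mul_rpow_of_nonneg _ _ hq0.le]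
        push_cast
        rw [ENNReal.coe_rpow_of_nonneg _ (by positivity), ENNReal.coe_rpow_of_nonneg _ hq0.le,
          ENNReal.coe_ofNat]
        ring

end FrequencyBand

section Covering

variable {Θ : Set ℝ} {δ : ℝ}

theorem coe_coverCount (hΘ : Bornology.IsBounded Θ) (hδ : 0 < δ) :
    (coverCount Θ δ : ℕ∞) = Metric.externalCoveringNumber (δ / 2).toNNReal Θ := by
  refine ENat.natCast_toNat ?_
  obtain ⟨C, -, hfin, hC⟩ := Metric.exists_finite_isCover_of_totallyBounded
    (ε := (δ / 2).toNNReal) (by simpa using hδ)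
    (hΘ.isCompact_closure.totallyBounded.subset subset_closure)
  exact ne_top_of_le_ne_top (Set.encard_ne_top_iff.2 hfin) hC.externalCoveringNumber_le_encard

theorem isCover_half_iff (hδ : 0 < δ) {c : Set ℝ} :
    Metric.IsCover (δ / 2).toNNReal Θ c ↔ ∀ θ ∈ Θ, ∃ z ∈ c, |θ - z| ≤ δ / 2 := by
  rw [Metric.isCover_iff_subset_iUnion_closedBall, Real.coe_toNNReal _ (half_pos hδ).le]
  simp only [Set.subset_def, Set.mem_iUnion₂, Metric.mem_closedBall, Real.dist_eq, exists_prop]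

theorem exists_finset_cover (hΘ : Bornology.IsBounded Θ) (hδ : 0 < δ) :
    ∃ c : Finset ℝ, c.card ≤ coverCount Θ δ ∧ ∀ θ ∈ Θ, ∃ z ∈ c, |θ - z| ≤ δ / 2 := by
  have hlt : Metric.externalCoveringNumber (δ / 2).toNNReal Θ < (coverCount Θ δ : ℕ∞) + 1 := by
    rw [← coe_coverCount hΘ hδ]
    exact_mod_cast Nat.lt_succ_self _
  simp only [Metric.externalCoveringNumber, iInf_lt_iff] at hlt
  obtain ⟨C, hC, hcard⟩ := hlt
  have hle : C.encard ≤ (coverCount Θ δ : ℕ∞) :=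
    (ENat.lt_add_one_iff (ENat.natCast_ne_top _)).1 hcard
  have hfin : C.Finite := Set.finite_of_encard_le_coe hle
  refine ⟨hfin.toFinset, ?_, by simpa using (isCover_half_iff hδ).1 hC⟩
  rw [hfin.encard_eq_coe_toFinset_card] at hle
  exact_mod_cast hle

theorem coverCount_le_card (hΘ : Bornology.IsBounded Θ) (hδ : 0 < δ) {c : Finset ℝ}
    (hc : ∀ θ ∈ Θ, ∃ z ∈ c, |θ - z| ≤ δ / 2) : coverCount Θ δ ≤ c.card := by
  have := ((isCover_half_iff (c := c) hδ).2 hc).externalCoveringNumber_le_encard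
  rw [← coe_coverCount hΘ hδ, Set.encard_coe_eq_coe_finsetCard] at this
  exact_mod_cast this

theorem exists_finset_cover_closedBall {R : ℝ} (hR : 0 ≤ R) (hδ : 0 < δ) :
    ∃ c : Finset ℝ, (c.card : ℝ) ≤ 2 * (R / δ) + 2 ∧
      ∀ θ : ℝ, |θ| ≤ R → ∃ z ∈ c, |θ - z| ≤ δ / 2 := by
  set b := R / δ + 1 / 2 with hb
  refine ⟨(Finset.Icc ⌈-b⌉ ⌊b⌋).image fun k : ℤ => k * δ, ?_, fun θ hθ => ?_⟩
  · refine (Nat.cast_le.2 Finset.card_image_le).trans ?_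
    have hcard : ((Finset.Icc ⌈-b⌉ ⌊b⌋).card : ℤ) = ⌊b⌋ + 1 - ⌈-b⌉ := by
      rw [Int.card_Icc, Int.ceil_neg, Int.toNat_of_nonneg]
      have : 0 ≤ ⌊b⌋ := Int.floor_nonneg.2 (by positivity)
      omega
    rw [← Int.cast_natCast, hcard]
    push_cast
    linarith [Int.floor_le b, Int.le_ceil (-b)]
  · have hround := abs_sub_round (θ / δ)
    refine ⟨round (θ / δ) * δ, Finset.mem_image_of_mem _ (Finset.mem_Icc.2 ?_), ?_⟩
    · have hθδ : |θ / δ| ≤ R / δ := by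
        rw [abs_div, abs_of_pos hδ]
        gcongr
      rw [abs_le] at hround hθδ
      exact ⟨Int.ceil_le.2 (by linarith), Int.le_floor.2 (by linarith)⟩
    · calc |θ - round (θ / δ) * δ| = |θ / δ - round (θ / δ)| * δ := by
            rw [← abs_of_pos hδ, ← abs_mul, abs_of_pos hδ, sub_mul, div_mul_cancel₀ _ hδ.ne']
        _ ≤ 1 / 2 * δ := by gcongr
        _ = δ / 2 := by ring

theorem exists_coverCount_le_div (hΘ : Bornology.IsBounded Θ) :
    ∃ K : ℝ, 0 < K ∧ ∀ δ : ℝ, 0 < δ → δ ≤ 1 → (coverCount Θ δ : ℝ) ≤ K / δ := by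
  obtain ⟨R, hR0, hR⟩ := hΘ.exists_pos_norm_le
  refine ⟨2 * R + 2, by positivity, fun δ hδ hδ1 => ?_⟩
  obtain ⟨c, hcard, hc⟩ := exists_finset_cover_closedBall hR0.le hδ
  calc (coverCount Θ δ : ℝ) ≤ c.card :=
        Nat.cast_le.2 (coverCount_le_card hΘ hδ fun θ hθ => hc θ (hR θ hθ))
    _ ≤ 2 * (R / δ) + 2 := hcard
    _ ≤ (2 * R + 2) / δ := by
        rw [add_div, mul_div_assoc]
        gcongr
        exact le_div_self zero_le_two hδ hδ1

theorem log_natCast_div_neg_log_le_iff (n : ℕ) {b : ℝ} (hδ : 0 < δ) (hδ1 : δ < 1) (hb : 0 ≤ b) :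
    Real.log n / -Real.log δ ≤ b ↔ (n : ℝ) ≤ δ ^ (-b) := by
  rcases n.eq_zero_or_pos with rfl | hn
  · simp [hb, Real.rpow_nonneg hδ.le]
  · rw [div_le_iff₀ (neg_pos.2 (Real.log_neg hδ hδ1)),
      Real.le_rpow_iff_log_le (Nat.cast_pos.2 hn) hδ, mul_neg, neg_mul]

theorem isBoundedUnder_log_coverCount (hΘ : Bornology.IsBounded Θ) :
    IsBoundedUnder (· ≤ ·) (𝓝[>] (0 : ℝ))
      fun δ : ℝ => Real.log (coverCount Θ δ) / (-Real.log δ) := by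
  obtain ⟨K, hK, hle⟩ := exists_coverCount_le_div hΘ
  refine ⟨2, eventually_map.2 ?_⟩
  filter_upwards [Ioo_mem_nhdsGT one_pos, Ioo_mem_nhdsGT (inv_pos.2 hK)] with δ hδ hδK
  rw [log_natCast_div_neg_log_le_iff _ hδ.1 hδ.2 zero_le_two, Real.rpow_neg hδ.1.le, Real.rpow_two,
    ← one_div, sq, ← div_div]
  refine (hle δ hδ.1 hδ.2.le).trans (div_le_div_of_nonneg_right ?_ hδ.1.le)
  rw [le_div_iff₀ hδ.1]
  exact ((lt_inv_mul_iff₀ hK).1 (by simpa using hδK.2)).le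

theorem upperMinkowskiDim_nonneg (hΘ : Bornology.IsBounded Θ) : 0 ≤ upperMinkowskiDim Θ := by
  refine le_limsup_of_le (isBoundedUnder_log_coverCount hΘ) fun b hb => ?_
  obtain ⟨δ, hδ, hδ1⟩ := (hb.and (Ioo_mem_nhdsGT one_pos)).exists
  refine le_trans (div_nonneg (Real.log_natCast_nonneg _) ?_) hδ
  exact neg_nonneg.2 (Real.log_nonpos hδ1.1.le hδ1.2.le)

theorem eventually_coverCount_le_rpow (hΘ : Bornology.IsBounded Θ) {b : ℝ}
    (hb : upperMinkowskiDim Θ < b) :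
    ∀ᶠ δ in 𝓝[>] (0 : ℝ), (coverCount Θ δ : ℝ) ≤ δ ^ (-b) := by
  filter_upwards [eventually_lt_of_limsup_lt hb (isBoundedUnder_log_coverCount hΘ),
    Ioo_mem_nhdsGT one_pos] with δ hδ hδ1
  exact (log_natCast_div_neg_log_le_iff _ hδ1.1 hδ1.2
    ((upperMinkowskiDim_nonneg hΘ).trans hb.le)).1 hδ.le

theorem exists_coverCount_le_rpow (hΘ : Bornology.IsBounded Θ) {b : ℝ}
    (hb : upperMinkowskiDim Θ < b) :
    ∃ C : ℝ≥0, ∀ δ : ℝ, 0 < δ → δ ≤ 1 → (coverCount Θ δ : ℝ) ≤ C * δ ^ (-b) := by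
  obtain ⟨K, hK, hle⟩ := exists_coverCount_le_div hΘ
  obtain ⟨δ₀, hδ₀, hsmall⟩ :=
    mem_nhdsGT_iff_exists_Ioo_subset.1 (eventually_coverCount_le_rpow hΘ hb)
  replace hδ₀ : 0 < δ₀ := hδ₀
  refine ⟨(1 + K / δ₀).toNNReal, fun δ hδ hδ1 => ?_⟩
  have hone : 1 ≤ δ ^ (-b) := Real.one_le_rpow_of_pos_of_le_one_of_nonpos hδ hδ1
    (neg_nonpos.2 ((upperMinkowskiDim_nonneg hΘ).trans hb.le))
  rw [Real.coe_toNNReal _ (by positivity), add_mul, one_mul]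
  rcases lt_or_ge δ δ₀ with hlt | hge
  · exact (hsmall ⟨hδ, hlt⟩ : (coverCount Θ δ : ℝ) ≤ δ ^ (-b)).trans
      (le_add_of_nonneg_right (by positivity))
  · calc (coverCount Θ δ : ℝ) ≤ K / δ := hle δ hδ hδ1
      _ ≤ K / δ₀ := by gcongr
      _ ≤ K / δ₀ * δ ^ (-b) := le_mul_of_one_le_right (by positivity) hone
      _ ≤ _ := le_add_of_nonneg_left (by positivity)

end Covering

section DyadicBlock

variable {Θ : Set ℝ} {α C₁ C₂ C₃ κ q b σ : ℝ}

theorem supAlong_rpow_le_sum {ι : Type*} {c : Finset ι} {Θ' : ι → Set ℝ} (γ : ℝ → ℝ → ℝ → ℝ)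
    (u : ℝ → ℝ → ℂ) (hcover : ∀ θ ∈ Θ, ∃ z ∈ c, θ ∈ Θ' z) {p : ℝ} (hp : 0 < p) (x : ℝ) :
    supAlong Θ γ u x ^ p ≤ ∑ z ∈ c, supAlong (Θ' z) γ u x ^ p := by
  rw [← ENNReal.le_rpow_inv_iff hp]
  refine supAlong_le fun t ht θ hθ => ?_
  obtain ⟨z, hz, hθz⟩ := hcover θ hθ
  rw [ENNReal.le_rpow_inv_iff hp]
  exact (ENNReal.rpow_le_rpow (le_supAlong γ u x ht hθz) hp.le).trans
    (Finset.single_le_sum (f := fun z => supAlong (Θ' z) γ u x ^ p) (fun _ _ => zero_le) hz)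

theorem exists_lintegral_supAlong_annulus_rpow_le (hΘ : Bornology.IsBounded Θ) (hα : 0 < α)
    (hα2 : 2 * α ≤ 1) (hκ : 0 < κ) (hακ : 4 * α * κ ≤ 1) (hC₁ : 0 < C₁) (hC₂ : 0 ≤ C₂)
    (hC₃ : 0 ≤ C₃) (hq : 1 ≤ q) (hκq : κ * q < 1) (hb : upperMinkowskiDim Θ < b) (x₀ r : ℝ) :
    ∃ C : ℝ≥0, ∀ γ, IsCurveFamily Θ α C₁ C₂ C₃ γ → ∀ h : ℝ → ℂ, Measurable h →
      ∀ ℓ : ℝ, 1 ≤ ℓ → IntegrableOn h (annulus ℓ) →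
      ∫⁻ x in Metric.ball x₀ r, supAlong Θ γ (bandIntegral (annulus ℓ) h) x ^ (2 * q) ≤
        C * ENNReal.ofReal (ℓ ^ (2 * α * b)) * ENNReal.ofReal (ℓ ^ (1 - 2 * α * κ)) ^ q *
          (∫⁻ ξ in annulus ℓ, ‖h ξ‖ₑ ^ (2 : ℝ)) ^ q := by
  obtain ⟨C, hC⟩ := exists_lintegral_supAlong_rpow_le_of_diam_le Θ hα hα2 hκ hακ hC₁ hC₂ hC₃ hq hκq
    x₀ r
  obtain ⟨N, hN⟩ := exists_coverCount_le_rpow hΘ hb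
  refine ⟨N * C, fun γ hγ h hm ℓ hℓ hh => ?_⟩
  have hℓ0 : 0 < ℓ := one_pos.trans_le hℓ
  set δ : ℝ := ℓ ^ (-(2 * α)) with hδ
  have hδ0 : 0 < δ := Real.rpow_pos_of_pos hℓ0 _
  have hδ1 : δ ≤ 1 := Real.rpow_le_one_of_one_le_of_nonpos hℓ (by linarith)
  obtain ⟨c, hcard, hcover⟩ := exists_finset_cover hΘ hδ0
  have hcard' : (c.card : ℝ≥0∞) ≤ N * ENNReal.ofReal (ℓ ^ (2 * α * b)) := by
    have := ENNReal.ofReal_le_ofReal ((Nat.cast_le.2 hcard).trans (hN δ hδ0 hδ1))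
    rwa [hδ, ← Real.rpow_mul hℓ0.le, neg_mul_neg, ENNReal.ofReal_natCast,
      ENNReal.ofReal_mul N.coe_nonneg, ENNReal.ofReal_coe_nnreal] at this
  let Θ' : ℝ → Set ℝ := fun z => {θ ∈ Θ | |θ - z| ≤ δ / 2}
  have hsub : ∀ z, Θ' z ⊆ Θ := fun z => Set.sep_subset _ _
  have hdiam : ∀ z, ∀ θ ∈ Θ' z, ∀ θ' ∈ Θ' z, |θ - θ'| ≤ δ := fun z θ hθ θ' hθ' => by
    linarith [abs_sub_le θ z θ', hθ.2, abs_sub_comm z θ', hθ'.2]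
  set u := bandIntegral (annulus ℓ) h
  have hmeas : ∀ z, Measurable (supAlong (Θ' z) γ u) := fun z =>
    measurable_supAlong (hγ.mono (hsub z)) fun t => (continuous_bandIntegral hh).uncurry_left t
  calc ∫⁻ x in Metric.ball x₀ r, supAlong Θ γ u x ^ (2 * q)
      ≤ ∫⁻ x in Metric.ball x₀ r, ∑ z ∈ c, supAlong (Θ' z) γ u x ^ (2 * q) :=
        lintegral_mono fun x => supAlong_rpow_le_sum (Θ' := Θ') γ u
          (fun θ hθ => (hcover θ hθ).imp fun z hz => ⟨hz.1, hθ, hz.2⟩) (by positivity) x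
    _ = ∑ z ∈ c, ∫⁻ x in Metric.ball x₀ r, supAlong (Θ' z) γ u x ^ (2 * q) :=
        lintegral_finsetSum _ fun z _ => (hmeas z).pow_const _
    _ ≤ c.card • _ := Finset.sum_le_card_nsmul _ _ _ fun z _ =>
        hC γ hγ h hm ℓ hℓ hh (Θ' z) (hsub z) (hdiam z)
    _ ≤ (N * ENNReal.ofReal (ℓ ^ (2 * α * b))) * _ := by
        rw [nsmul_eq_mul]
        exact mul_le_mul_left hcard' _
    _ = _ := by
        push_cast
        ring

theorem lintegral_enorm_rpow_two {X : Type*} [MeasurableSpace X] (μ : Measure X) (h : X → ℂ) :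
    ∫⁻ x, ‖h x‖ₑ ^ (2 : ℝ) ∂μ = eLpNorm h 2 μ ^ (2 : ℝ) := by
  rw [eLpNorm_eq_lintegral_rpow_enorm_toReal two_ne_zero ENNReal.ofNat_ne_top, ← ENNReal.rpow_mul]
  norm_num

theorem exists_eLpNorm_supAlong_annulus_le (hΘ : Bornology.IsBounded Θ) (hα : 0 < α)
    (hα2 : 2 * α ≤ 1) (hκ : 0 < κ) (hακ : 4 * α * κ ≤ 1) (hC₁ : 0 < C₁) (hC₂ : 0 ≤ C₂)
    (hC₃ : 0 ≤ C₃) (hq : 1 ≤ q) (hκq : κ * q < 1) (hb : upperMinkowskiDim Θ < b) (x₀ r : ℝ) :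
    ∃ C : ℝ≥0, ∀ γ, IsCurveFamily Θ α C₁ C₂ C₃ γ → ∀ h : ℝ → ℂ, Measurable h →
      ∀ ℓ : ℝ, 1 ≤ ℓ → IntegrableOn h (annulus ℓ) →
      eLpNorm (supAlong Θ γ (bandIntegral (annulus ℓ) h)) (ENNReal.ofReal (2 * q))
          (volume.restrict (Metric.ball x₀ r)) ≤
        C * ENNReal.ofReal (ℓ ^ (1 / 2 + α * (b / q - κ))) *
          eLpNorm h 2 (volume.restrict (annulus ℓ)) := by
  obtain ⟨C, hC⟩ := exists_lintegral_supAlong_annulus_rpow_le hΘ hα hα2 hκ hακ hC₁ hC₂ hC₃ hq hκq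
    hb x₀ r
  have hq0 : 0 < q := one_pos.trans_le hq
  refine ⟨C ^ (1 / (2 * q)), fun γ hγ h hm ℓ hℓ hh => ?_⟩
  have hℓ0 : 0 < ℓ := one_pos.trans_le hℓ
  rw [eLpNorm_eq_lintegral_rpow_enorm_toReal (by simpa using hq0) ENNReal.ofReal_ne_top,
    ENNReal.toReal_ofReal (by positivity)]
  simp_rw [enorm_eq_self]
  refine (ENNReal.rpow_le_rpow (hC γ hγ h hm ℓ hℓ hh) (by positivity)).trans_eq ?_
  have hexp : ℓ ^ (2 * α * b) * (ℓ ^ (1 - 2 * α * κ)) ^ q =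
      (ℓ ^ (1 / 2 + α * (b / q - κ))) ^ (2 * q) := by
    rw [← Real.rpow_mul hℓ0.le, ← Real.rpow_mul hℓ0.le, ← Real.rpow_add hℓ0]
    congr 1
    field_simp
    ring
  rw [lintegral_enorm_rpow_two, ← ENNReal.rpow_mul,
    ENNReal.ofReal_rpow_of_nonneg (by positivity) hq0.le, mul_assoc (C : ℝ≥0∞),
    ← ENNReal.ofReal_mul (by positivity), hexp,
    ← ENNReal.ofReal_rpow_of_nonneg (by positivity) (by positivity),
    ENNReal.mul_rpow_of_nonneg _ _ (by positivity), ENNReal.mul_rpow_of_nonneg _ _ (by positivity),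
    ← ENNReal.rpow_mul, ← ENNReal.rpow_mul, mul_one_div_cancel (by positivity), ENNReal.rpow_one,
    ENNReal.rpow_one, ENNReal.coe_rpow_of_nonneg _ (by positivity)]

/- Any loss `κ < 1 / q` and any `b > β` are admissible in the previous bound, so the exponent of `ℓ`
comes as close as desired to `1 / 2 - α * (1 - β) / q`. -/
theorem exists_eLpNorm_supAlong_annulus_le_of_lt (hΘ : Bornology.IsBounded Θ) (hα : 0 < α)
    (hα2 : 2 * α ≤ 1) (hC₁ : 0 < C₁) (hC₂ : 0 ≤ C₂) (hC₃ : 0 ≤ C₃) (hq : 1 ≤ q) (hαq : 4 * α ≤ q)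
    (hσ : 1 / 2 - α * (1 - upperMinkowskiDim Θ) / q < σ) (x₀ r : ℝ) :
    ∃ C : ℝ≥0, ∀ γ, IsCurveFamily Θ α C₁ C₂ C₃ γ → ∀ h : ℝ → ℂ, Measurable h →
      ∀ ℓ : ℝ, 1 ≤ ℓ → IntegrableOn h (annulus ℓ) →
      eLpNorm (supAlong Θ γ (bandIntegral (annulus ℓ) h)) (ENNReal.ofReal (2 * q))
          (volume.restrict (Metric.ball x₀ r)) ≤
        C * ENNReal.ofReal (ℓ ^ σ) * eLpNorm h 2 (volume.restrict (annulus ℓ)) := by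
  have hq0 : 0 < q := one_pos.trans_le hq
  set β := upperMinkowskiDim Θ
  obtain ⟨ε, hε0, hε⟩ : ∃ ε > 0, ε < 1 ∧ 1 / 2 + α * ((β + ε) / q - (1 - ε) / q) < σ := by
    have hlim : Tendsto (fun ε : ℝ => 1 / 2 + α * ((β + ε) / q - (1 - ε) / q)) (𝓝[>] 0)
        (𝓝 (1 / 2 + α * ((β + 0) / q - (1 - 0) / q))) :=
      (Continuous.tendsto (by fun_prop) 0).mono_left nhdsWithin_le_nhds
    have hlt : 1 / 2 + α * ((β + 0) / q - (1 - 0) / q) < σ :=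
      lt_of_eq_of_lt (by ring) hσ
    obtain ⟨ε, h, hε⟩ := ((hlim.eventually_lt_const hlt).and (Ioo_mem_nhdsGT one_pos)).exists
    exact ⟨ε, hε.1, hε.2, h⟩
  obtain ⟨hε1, hεσ⟩ := hε
  have hκ : 0 < (1 - ε) / q := div_pos (by linarith) hq0
  have hκq : (1 - ε) / q * q < 1 := by
    rw [div_mul_cancel₀ _ hq0.ne']
    linarith
  have hακ : 4 * α * ((1 - ε) / q) ≤ 1 := by
    rw [mul_comm]
    exact (mul_le_mul_of_nonneg_left hαq hκ.le).trans hκq.le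
  obtain ⟨C, hC⟩ := exists_eLpNorm_supAlong_annulus_le hΘ hα hα2 hκ hακ hC₁ hC₂ hC₃ hq hκq
    (lt_add_of_pos_right β hε0) x₀ r
  refine ⟨C, fun γ hγ h hm ℓ hℓ hh => (hC γ hγ h hm ℓ hℓ hh).trans ?_⟩
  gcongr

end DyadicBlock

section DyadicSummation

/-- The norm `‖(1 + |ξ|²)^{s/2} h‖_{L²}`, of which `sobolevNorm s f` is the value at `h = f̂`. -/
noncomputable def weightedNorm (s : ℝ) (h : ℝ → ℂ) : ℝ≥0∞ :=
  eLpNorm (fun ξ : ℝ => (((1 + ξ ^ 2) ^ (s / 2) : ℝ) : ℂ) * h ξ) 2 volume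

/-- The sum of bounds for the frequencies in `[-1, 1]` and in all the annuli
`annulus (2 ^ n)`. It dominates the maximal function, and where it is finite the truncated integrals
converge uniformly along the curves. -/
noncomputable def majorant (Θ : Set ℝ) (γ : ℝ → ℝ → ℝ → ℝ) (h : ℝ → ℂ) (x : ℝ) : ℝ≥0∞ :=
  (∫⁻ ξ in Set.Icc (-1 : ℝ) 1, ‖h ξ‖ₑ) +
    ∑' n : ℕ, supAlong Θ γ (bandIntegral (annulus (2 ^ n)) h) x

variable {Θ E : Set ℝ} {α C₁ C₂ C₃ q s ℓ : ℝ} {γ : ℝ → ℝ → ℝ → ℝ} {h : ℝ → ℂ}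

theorem norm_weight_mul (s : ℝ) (h : ℝ → ℂ) (ξ : ℝ) :
    ‖(((1 + ξ ^ 2) ^ (s / 2) : ℝ) : ℂ) * h ξ‖ = (1 + ξ ^ 2) ^ (s / 2) * ‖h ξ‖ := by
  rw [norm_mul, Complex.norm_of_nonneg (by positivity)]

theorem eLpNorm_le_weightedNorm (hs : 0 ≤ s) (h : ℝ → ℂ) : eLpNorm h 2 ≤ weightedNorm s h := by
  refine eLpNorm_mono fun ξ => ?_
  rw [norm_weight_mul]
  exact le_mul_of_one_le_left (norm_nonneg _)
    (Real.one_le_rpow (le_add_of_nonneg_right (sq_nonneg ξ)) (by positivity))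

theorem eLpNorm_annulus_le_weightedNorm (hs : 0 ≤ s) (hℓ : 0 < ℓ) (h : ℝ → ℂ) :
    eLpNorm h 2 (volume.restrict (annulus ℓ)) ≤ ENNReal.ofReal (ℓ ^ (-s)) * weightedNorm s h := by
  refine le_trans ?_ (mul_le_mul_right (eLpNorm_restrict_le _ _ _ (annulus ℓ)) _)
  refine eLpNorm_le_mul_eLpNorm_of_ae_le_mul ?_ 2
  filter_upwards [ae_restrict_mem (measurableSet_annulus ℓ)] with ξ hξ
  have hℓξ : ℓ ≤ |ξ| := (not_le.1 fun hle => hξ.2 (abs_le.1 hle)).le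
  have hweight : ℓ ^ s ≤ (1 + ξ ^ 2) ^ (s / 2) := by
    rw [show s = 2 * (s / 2) by ring, Real.rpow_mul hℓ.le, Real.rpow_two,
      mul_div_cancel_left₀ _ two_ne_zero]
    refine Real.rpow_le_rpow (sq_nonneg ℓ) ?_ (by positivity)
    linarith [sq_le_sq₀ hℓ.le (abs_nonneg ξ) |>.2 hℓξ, sq_abs ξ]
  rw [norm_weight_mul, ← mul_assoc]
  refine le_mul_of_one_le_left (norm_nonneg _) ?_
  rwa [Real.rpow_neg hℓ.le, le_inv_mul_iff₀ (by positivity), mul_one]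

theorem setLIntegral_enorm_le_weightedNorm (hs : 0 ≤ s) (hm : Measurable h) (E : Set ℝ) :
    ∫⁻ ξ in E, ‖h ξ‖ₑ ≤ weightedNorm s h * volume E ^ (1 / 2 : ℝ) := by
  have hHolder := eLpNorm_le_eLpNorm_mul_rpow_measure_univ (μ := volume.restrict E) one_le_two
    hm.aestronglyMeasurable
  rw [eLpNorm_one_eq_lintegral_enorm, Measure.restrict_apply_univ] at hHolder
  refine hHolder.trans (mul_le_mul' ((eLpNorm_restrict_le _ _ _ _).trans
    (eLpNorm_le_weightedNorm hs h)) (le_of_eq ?_))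
  norm_num

theorem integrableOn_of_weightedNorm_lt_top (hs : 0 ≤ s) (hm : Measurable h)
    (hh : weightedNorm s h < ∞) (hE : volume E < ∞) : IntegrableOn h E :=
  ⟨hm.aestronglyMeasurable, (setLIntegral_enorm_le_weightedNorm hs hm E).trans_lt
    (ENNReal.mul_lt_top hh (ENNReal.rpow_lt_top_of_nonneg (by positivity) hE.ne))⟩

theorem measurable_supAlong_bandIntegral (hγ : IsCurveFamily Θ α C₁ C₂ C₃ γ)
    (hh : IntegrableOn h E) : Measurable (supAlong Θ γ (bandIntegral E h)) :=
  measurable_supAlong hγ fun t => (continuous_bandIntegral hh).uncurry_left t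

theorem eLpNorm_tsum_le {X : Type*} [MeasurableSpace X] {μ : Measure X} {p : ℝ≥0∞}
    {M : ℕ → X → ℝ≥0∞} (hM : ∀ n, Measurable (M n)) (hp : 1 ≤ p) (hp_top : p ≠ ∞) :
    eLpNorm (fun x => ∑' n, M n x) p μ ≤ ∑' n, eLpNorm (M n) p μ := by
  have hp0 : p ≠ 0 := (one_pos.trans_le hp).ne'
  have hp_pos : 0 < p.toReal := ENNReal.toReal_pos hp0 hp_top
  have hpow : ∀ f : X → ℝ≥0∞, ∫⁻ x, f x ^ p.toReal ∂μ = eLpNorm f p μ ^ p.toReal := fun f => by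
    rw [eLpNorm_eq_lintegral_rpow_enorm_toReal hp0 hp_top, one_div,
      ENNReal.rpow_inv_rpow hp_pos.ne']
    simp_rw [enorm_eq_self]
  rw [← ENNReal.rpow_le_rpow_iff hp_pos, ← hpow]
  calc ∫⁻ x, (∑' n, M n x) ^ p.toReal ∂μ
      = ∫⁻ x, ⨆ N, (∑ n ∈ Finset.range N, M n x) ^ p.toReal ∂μ := by
        simp_rw [ENNReal.tsum_eq_iSup_nat]
        exact lintegral_congr fun x => (ENNReal.orderIsoRpow _ hp_pos).map_iSup _
    _ = ⨆ N, ∫⁻ x, (∑ n ∈ Finset.range N, M n x) ^ p.toReal ∂μ :=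
        lintegral_iSup (fun N => (Finset.measurable_fun_sum _ fun n _ => hM n).pow_const _)
          fun N N' hN x => by
            dsimp only
            gcongr
    _ ≤ (∑' n, eLpNorm (M n) p μ) ^ p.toReal := iSup_le fun N => by
        rw [hpow, ← Finset.sum_fn]
        gcongr
        exact (eLpNorm_sum_le (fun n _ => (hM n).aestronglyMeasurable) hp).trans
          (ENNReal.sum_le_tsum _)

theorem measurable_majorant (hγ : IsCurveFamily Θ α C₁ C₂ C₃ γ)
    (hh : ∀ n : ℕ, IntegrableOn h (annulus (2 ^ n))) : Measurable (majorant Θ γ h) :=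
  measurable_const.add (Measurable.tsum fun n => measurable_supAlong_bandIntegral hγ (hh n))

theorem eLpNorm_majorant_le (hγ : IsCurveFamily Θ α C₁ C₂ C₃ γ)
    (hh : ∀ n : ℕ, IntegrableOn h (annulus (2 ^ n))) {p : ℝ≥0∞} (hp : 1 ≤ p) (hp_top : p ≠ ∞)
    (μ : Measure ℝ) :
    eLpNorm (majorant Θ γ h) p μ ≤
      (∫⁻ ξ in Set.Icc (-1 : ℝ) 1, ‖h ξ‖ₑ) * μ Set.univ ^ (1 / p.toReal) +
        ∑' n : ℕ, eLpNorm (supAlong Θ γ (bandIntegral (annulus (2 ^ n)) h)) p μ := by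
  have hmeas := fun n => measurable_supAlong_bandIntegral hγ (hh n)
  have hconst := eLpNorm_const' (μ := μ) (∫⁻ ξ in Set.Icc (-1 : ℝ) 1, ‖h ξ‖ₑ)
    (one_pos.trans_le hp).ne' hp_top
  rw [enorm_eq_self] at hconst
  rw [← hconst]
  exact (eLpNorm_add_le aestronglyMeasurable_const
    (Measurable.tsum hmeas).aestronglyMeasurable hp).trans
    (add_le_add_right (eLpNorm_tsum_le hmeas hp hp_top) _)

theorem exists_eLpNorm_supAlong_annulus_two_pow_le (hΘ : Bornology.IsBounded Θ) (hα : 0 < α)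
    (hα2 : 2 * α ≤ 1) (hC₁ : 0 < C₁) (hC₂ : 0 ≤ C₂) (hC₃ : 0 ≤ C₃) (hq : 1 ≤ q) (hαq : 4 * α ≤ q)
    (hs0 : 0 ≤ s) (hs : 1 / 2 - α * (1 - upperMinkowskiDim Θ) / q < s) (x₀ r : ℝ) :
    ∃ C : ℝ≥0, ∃ ρ < (1 : ℝ≥0∞), ∀ γ, IsCurveFamily Θ α C₁ C₂ C₃ γ → ∀ h : ℝ → ℂ, Measurable h →
      ∀ n : ℕ, IntegrableOn h (annulus (2 ^ n)) →
      eLpNorm (supAlong Θ γ (bandIntegral (annulus (2 ^ n)) h)) (ENNReal.ofReal (2 * q))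
          (volume.restrict (Metric.ball x₀ r)) ≤ C * ρ ^ n * weightedNorm s h := by
  obtain ⟨σ, hσ, hσs⟩ := exists_between hs
  obtain ⟨C, hC⟩ := exists_eLpNorm_supAlong_annulus_le_of_lt hΘ hα hα2 hC₁ hC₂ hC₃ hq hαq hσ x₀ r
  refine ⟨C, ENNReal.ofReal (2 ^ (σ - s)), ?_, fun γ hγ h hm n hh => ?_⟩
  · rw [ENNReal.ofReal_lt_one]
    exact Real.rpow_lt_one_of_one_lt_of_neg one_lt_two (sub_neg.2 hσs)
  have hratio : ENNReal.ofReal ((2 ^ n) ^ σ) * ENNReal.ofReal ((2 ^ n) ^ (-s)) =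
      ENNReal.ofReal (2 ^ (σ - s)) ^ n := by
    rw [← ENNReal.ofReal_mul (by positivity), ← Real.rpow_add (by positivity), ← sub_eq_add_neg,
      ← ENNReal.ofReal_pow (by positivity), Real.rpow_pow_comm zero_le_two]
  calc _ ≤ C * ENNReal.ofReal ((2 ^ n) ^ σ) * eLpNorm h 2 (volume.restrict (annulus (2 ^ n))) :=
        hC γ hγ h hm _ (one_le_pow₀ one_le_two) hh
    _ ≤ C * ENNReal.ofReal ((2 ^ n) ^ σ) *
        (ENNReal.ofReal ((2 ^ n) ^ (-s)) * weightedNorm s h) := by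
        gcongr
        exact eLpNorm_annulus_le_weightedNorm hs0 (by positivity) h
    _ = C * ENNReal.ofReal (2 ^ (σ - s)) ^ n * weightedNorm s h := by
        rw [← hratio]
        ring

theorem exists_eLpNorm_majorant_le (hΘ : Bornology.IsBounded Θ) (hα : 0 < α) (hα2 : 2 * α ≤ 1)
    (hC₁ : 0 < C₁) (hC₂ : 0 ≤ C₂) (hC₃ : 0 ≤ C₃) (hq : 1 ≤ q) (hαq : 4 * α ≤ q) (hs0 : 0 ≤ s)
    (hs : 1 / 2 - α * (1 - upperMinkowskiDim Θ) / q < s) (x₀ r : ℝ) :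
    ∃ C : ℝ≥0, ∀ γ, IsCurveFamily Θ α C₁ C₂ C₃ γ → ∀ h : ℝ → ℂ, Measurable h →
      weightedNorm s h < ∞ →
      eLpNorm (majorant Θ γ h) (ENNReal.ofReal (2 * q)) (volume.restrict (Metric.ball x₀ r)) ≤
        C * weightedNorm s h := by
  obtain ⟨C, ρ, hρ, hC⟩ := exists_eLpNorm_supAlong_annulus_two_pow_le hΘ hα hα2 hC₁ hC₂ hC₃ hq hαq
    hs0 hs x₀ r
  set p := ENNReal.ofReal (2 * q)
  have hp : 1 ≤ p := ENNReal.one_le_ofReal.2 (by linarith)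
  set V := volume (Metric.ball x₀ r) ^ (1 / p.toReal)
  set A : ℝ≥0∞ := volume (Set.Icc (-1 : ℝ) 1) ^ (1 / 2 : ℝ) * V + C * (1 - ρ)⁻¹
  have hA : A ≠ ∞ := by
    refine ENNReal.add_ne_top.2 ⟨ENNReal.mul_ne_top ?_ ?_, ENNReal.mul_ne_top ENNReal.coe_ne_top
      (ENNReal.inv_ne_top.2 (tsub_pos_of_lt hρ).ne')⟩
    · exact ENNReal.rpow_ne_top_of_nonneg (by positivity) measure_Icc_lt_top.ne
    · exact ENNReal.rpow_ne_top_of_nonneg (by positivity) measure_ball_lt_top.ne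
  refine ⟨A.toNNReal, fun γ hγ h hm hh => ?_⟩
  have hint : ∀ n : ℕ, IntegrableOn h (annulus (2 ^ n)) := fun n =>
    integrableOn_of_weightedNorm_lt_top hs0 hm hh (volume_annulus_lt_top _)
  have hmajorant := eLpNorm_majorant_le hγ hint hp ENNReal.ofReal_ne_top
    (volume.restrict (Metric.ball x₀ r))
  rw [Measure.restrict_apply_univ] at hmajorant
  refine hmajorant.trans ?_
  calc _ ≤ weightedNorm s h * volume (Set.Icc (-1 : ℝ) 1) ^ (1 / 2 : ℝ) * V +
        ∑' n, C * ρ ^ n * weightedNorm s h :=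
        add_le_add (mul_le_mul_left (setLIntegral_enorm_le_weightedNorm hs0 hm _) _)
          (ENNReal.tsum_le_tsum fun n => hC γ hγ h hm n (hint n))
    _ = A * weightedNorm s h := by
        rw [ENNReal.tsum_mul_right, ENNReal.tsum_mul_left, ENNReal.tsum_geometric]
        ring
    _ = A.toNNReal * weightedNorm s h := by rw [ENNReal.coe_toNNReal hA]

end DyadicSummation

section Pointwise

variable {Θ : Set ℝ} {γ : ℝ → ℝ → ℝ → ℝ} {f : Lp ℂ 2 (volume : Measure ℝ)} {t x θ : ℝ}

theorem supAlong_le_supAlong_add {u v : ℝ → ℝ → ℂ} {B : ℝ≥0∞}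
    (h : ∀ t ∈ Set.Ioo (0 : ℝ) 1, ∀ θ ∈ Θ, ‖u t (γ x t θ) - v t (γ x t θ)‖ₑ ≤ B) :
    supAlong Θ γ u x ≤ supAlong Θ γ v x + B :=
  supAlong_le fun t ht θ hθ => calc
    ‖u t (γ x t θ)‖ₑ = ‖v t (γ x t θ) + (u t (γ x t θ) - v t (γ x t θ))‖ₑ := by rw [add_sub_cancel]
    _ ≤ ‖v t (γ x t θ)‖ₑ + ‖u t (γ x t θ) - v t (γ x t θ)‖ₑ := enorm_add_le _ _
    _ ≤ supAlong Θ γ v x + B := add_le_add (le_supAlong γ v x ht hθ) (h t ht θ hθ)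

theorem measurable_hat (f : Lp ℂ 2 (volume : Measure ℝ)) : Measurable (hat f) :=
  (Lp.stronglyMeasurable _).measurable.comp (measurable_id.div_const _)

theorem schrodingerTrunc_eq_bandIntegral (f : Lp ℂ 2 (volume : Measure ℝ)) (k : ℕ) (t y : ℝ) :
    schrodingerTrunc f k t y =
      (2 * Real.pi : ℂ)⁻¹ * bandIntegral (Set.Icc (-(2 : ℝ) ^ k) ((2 : ℝ) ^ k)) (hat f) t y :=
  rfl

theorem bandIntegral_Icc_eq_sum {h : ℝ → ℂ} (hh : ∀ R : ℝ, IntegrableOn h (Set.Icc (-R) R))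
    (t y : ℝ) (k : ℕ) :
    bandIntegral (Set.Icc (-(2 : ℝ) ^ k) ((2 : ℝ) ^ k)) h t y =
      bandIntegral (Set.Icc (-1) 1) h t y +
        ∑ n ∈ Finset.range k, bandIntegral (annulus (2 ^ n)) h t y := by
  induction k with
  | zero => simp
  | succ k ih =>
    have hint : IntegrableOn (fun ξ => phase t y ξ * h ξ)
        (Set.Icc (-(2 * (2 : ℝ) ^ k)) (2 * (2 : ℝ) ^ k)) :=
      (hh (2 * 2 ^ k)).bdd_mul (continuous_phase_right t y).aestronglyMeasurable
        (ae_of_all _ fun ξ => (norm_phase t y ξ).le)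
    rw [Finset.sum_range_succ, ← add_assoc, ← ih, pow_succ']
    exact eq_add_of_sub_eq' (setIntegral_annulus (by positivity) hint).symm

theorem enorm_inv_two_pi_mul_le (z : ℂ) : ‖(2 * Real.pi : ℂ)⁻¹ * z‖ₑ ≤ ‖z‖ₑ := by
  rw [enorm_le_iff_norm_le, norm_mul, norm_inv, norm_mul, Complex.norm_ofNat,
    Complex.norm_of_nonneg Real.pi_pos.le]
  exact mul_le_of_le_one_left (norm_nonneg z)
    (inv_le_one_of_one_le₀ (by linarith [Real.pi_gt_three]))

theorem exists_tendsto_schrodingerTrunc (hh : ∀ R : ℝ, IntegrableOn (hat f) (Set.Icc (-R) R))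
    (hx : majorant Θ γ (hat f) x ≠ ∞)
    (ht : t ∈ Set.Ioo (0 : ℝ) 1) (hθ : θ ∈ Θ) :
    ∃ z : ℂ, Tendsto (fun k : ℕ => schrodingerTrunc f k t (γ x t θ)) atTop (𝓝 z) ∧
      ∀ k : ℕ, ‖z - schrodingerTrunc f k t (γ x t θ)‖ₑ ≤
        ∑' n : ℕ, supAlong Θ γ (bandIntegral (annulus (2 ^ (n + k))) (hat f)) x := by
  set c : ℕ → ℂ := fun n => bandIntegral (annulus (2 ^ n)) (hat f) t (γ x t θ)
  have hc : ∀ n, ‖c n‖ₑ ≤ supAlong Θ γ (bandIntegral (annulus (2 ^ n)) (hat f)) x := fun n =>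
    le_supAlong γ _ x ht hθ
  have hsum : Summable c := Summable.of_nnnorm <| ENNReal.tsum_coe_ne_top_iff_summable.1 <|
    ne_top_of_le_ne_top (ENNReal.add_ne_top.1 hx).2 (ENNReal.tsum_le_tsum hc)
  have htrunc : ∀ k, schrodingerTrunc f k t (γ x t θ) = (2 * Real.pi : ℂ)⁻¹ *
      (bandIntegral (Set.Icc (-1) 1) (hat f) t (γ x t θ) + ∑ n ∈ Finset.range k, c n) := fun k => by
    rw [schrodingerTrunc_eq_bandIntegral, bandIntegral_Icc_eq_sum hh]
  refine ⟨(2 * Real.pi : ℂ)⁻¹ *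
    (bandIntegral (Set.Icc (-1) 1) (hat f) t (γ x t θ) + ∑' n, c n), ?_, fun k => ?_⟩
  · simp_rw [htrunc]
    exact (hsum.hasSum.tendsto_sum_nat.const_add _).const_mul _
  · rw [htrunc, ← mul_sub, add_sub_add_left_eq_sub, ← hsum.sum_add_tsum_nat_add k,
      add_sub_cancel_left]
    calc _ ≤ ‖∑' n, c (n + k)‖ₑ := enorm_inv_two_pi_mul_le _
      _ ≤ ∑' n, ‖c (n + k)‖ₑ := enorm_tsum_le_tsum_enorm
      _ ≤ _ := ENNReal.tsum_le_tsum fun n => hc (n + k)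

theorem schrodingerDefinedAt_of_majorant_ne_top
    (hh : ∀ R : ℝ, IntegrableOn (hat f) (Set.Icc (-R) R))
    (hx : majorant Θ γ (hat f) x ≠ ∞)
    (ht : t ∈ Set.Ioo (0 : ℝ) 1) (hθ : θ ∈ Θ) : SchrodingerDefinedAt f t (γ x t θ) :=
  (exists_tendsto_schrodingerTrunc hh hx ht hθ).imp fun _ => And.left

theorem enorm_schrodinger_sub_schrodingerTrunc_le
    (hh : ∀ R : ℝ, IntegrableOn (hat f) (Set.Icc (-R) R))
    (hx : majorant Θ γ (hat f) x ≠ ∞)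
    (ht : t ∈ Set.Ioo (0 : ℝ) 1) (hθ : θ ∈ Θ) (k : ℕ) :
    ‖schrodinger f t (γ x t θ) - schrodingerTrunc f k t (γ x t θ)‖ₑ ≤
      ∑' n : ℕ, supAlong Θ γ (bandIntegral (annulus (2 ^ (n + k))) (hat f)) x := by
  obtain ⟨z, hz, hzk⟩ := exists_tendsto_schrodingerTrunc hh hx ht hθ
  rw [schrodinger, hz.limUnder_eq]
  exact hzk k

theorem maximalFunction_le_majorant (hh : ∀ R : ℝ, IntegrableOn (hat f) (Set.Icc (-R) R)) :
    maximalFunction Θ γ f x ≤ majorant Θ γ (hat f) x := by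
  rcases eq_or_ne (majorant Θ γ (hat f) x) ∞ with hx | hx
  · exact hx ▸ le_top
  have hlow : supAlong Θ γ (schrodingerTrunc f 0) x ≤ ∫⁻ ξ in Set.Icc (-1 : ℝ) 1, ‖hat f ξ‖ₑ := by
    refine supAlong_le fun t _ θ _ => ?_
    rw [schrodingerTrunc_eq_bandIntegral, pow_zero]
    exact (enorm_inv_two_pi_mul_le _).trans (enorm_bandIntegral_le _ _ _ _)
  exact (supAlong_le_supAlong_add fun t ht θ hθ =>
    enorm_schrodinger_sub_schrodingerTrunc_le hh hx ht hθ 0).trans (add_le_add_left hlow _)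

theorem tendsto_supAlong_schrodingerTrunc (hh : ∀ R : ℝ, IntegrableOn (hat f) (Set.Icc (-R) R))
    (hx : majorant Θ γ (hat f) x ≠ ∞) :
    Tendsto (fun k : ℕ => supAlong Θ γ (schrodingerTrunc f k) x) atTop
      (𝓝 (maximalFunction Θ γ f x)) := by
  set M : ℕ → ℝ≥0∞ := fun n => supAlong Θ γ (bandIntegral (annulus (2 ^ n)) (hat f)) x
  have htail : Tendsto (fun k => ∑' n, M (n + k)) atTop (𝓝 0) :=
    ENNReal.tendsto_sum_nat_add M (ENNReal.add_ne_top.1 hx).2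
  have hfin : maximalFunction Θ γ f x ≠ ∞ :=
    ne_top_of_le_ne_top hx (maximalFunction_le_majorant hh)
  have hdiff := fun k t ht θ hθ =>
    enorm_schrodinger_sub_schrodingerTrunc_le (t := t) (θ := θ) hh hx ht hθ k
  refine tendsto_of_tendsto_of_tendsto_of_le_of_le
    (g := fun k => maximalFunction Θ γ f x - ∑' n, M (n + k))
    (h := fun k => maximalFunction Θ γ f x + ∑' n, M (n + k)) ?_ ?_ (fun k => ?_) fun k => ?_
  · simpa using ENNReal.Tendsto.sub tendsto_const_nhds htail (Or.inl hfin)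
  · simpa using tendsto_const_nhds.add htail
  · exact tsub_le_iff_right.2 (supAlong_le_supAlong_add (hdiff k))
  · refine supAlong_le_supAlong_add fun t ht θ hθ => ?_
    rw [enorm_sub_rev]
    exact hdiff k t ht θ hθ

end Pointwise

section MaximalEstimate

variable {Θ : Set ℝ} {α C₁ C₂ C₃ q s x₀ r : ℝ} {p : ℝ≥0∞}

theorem ae_ne_top_of_eLpNorm_lt_top {X : Type*} [MeasurableSpace X] {μ : Measure X}
    {g : X → ℝ≥0∞} (hg : Measurable g) (hp : p ≠ 0) (hp_top : p ≠ ∞) (h : eLpNorm g p μ < ∞) :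
    ∀ᵐ x ∂μ, g x ≠ ∞ := by
  rw [eLpNorm_lt_top_iff_lintegral_rpow_enorm_lt_top hp hp_top] at h
  simp only [enorm_eq_self] at h
  filter_upwards [ae_lt_top (hg.pow_const _) h.ne] with x hx hx_top
  exact hx.ne (hx_top ▸ ENNReal.top_rpow_of_pos (ENNReal.toReal_pos hp hp_top))

theorem MaximalEstimate.mono_holder {α' : ℝ} (h : MaximalEstimate Θ α' C₁ C₂ C₃ x₀ r s p)
    (hα' : 0 ≤ α') (hα : α' ≤ α) (hC₂ : 0 ≤ C₂) : MaximalEstimate Θ α C₁ C₂ C₃ x₀ r s p :=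
  h.imp fun _ hC γ hγ => hC γ (hγ.mono_holder hα' hα hC₂)

theorem maximalEstimate_of_eLpNorm_majorant_le (hs : 0 ≤ s) (hp : p ≠ 0) (hp_top : p ≠ ∞)
    {C : ℝ≥0}
    (hC : ∀ γ, IsCurveFamily Θ α C₁ C₂ C₃ γ → ∀ h : ℝ → ℂ, Measurable h → weightedNorm s h < ∞ →
      eLpNorm (majorant Θ γ h) p (volume.restrict (Metric.ball x₀ r)) ≤ C * weightedNorm s h) :
    MaximalEstimate Θ α C₁ C₂ C₃ x₀ r s p := by
  refine ⟨C, fun γ hγ f hf => ?_⟩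
  have hf' : weightedNorm s (hat f) < ∞ := hf
  have hle : eLpNorm (majorant Θ γ (hat f)) p (volume.restrict (Metric.ball x₀ r)) ≤
      C * weightedNorm s (hat f) := hC γ hγ (hat f) (measurable_hat f) hf'
  have hint : ∀ E : Set ℝ, volume E < ∞ → IntegrableOn (hat f) E := fun E =>
    integrableOn_of_weightedNorm_lt_top hs (measurable_hat f) hf'
  have hint_Icc : ∀ R : ℝ, IntegrableOn (hat f) (Set.Icc (-R) R) := fun R =>
    hint _ measure_Icc_lt_top
  have hmajorant : Measurable (majorant Θ γ (hat f)) :=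
    measurable_majorant hγ fun n => hint _ (volume_annulus_lt_top _)
  have hfinite : ∀ᵐ x ∂(volume.restrict (Metric.ball x₀ r)), majorant Θ γ (hat f) x ≠ ∞ :=
    ae_ne_top_of_eLpNorm_lt_top hmajorant hp hp_top
      (hle.trans_lt (ENNReal.mul_lt_top ENNReal.coe_lt_top hf'))
  refine ⟨?_, ?_, ?_⟩
  · filter_upwards [hfinite] with x hx t ht θ hθ
    exact schrodingerDefinedAt_of_majorant_ne_top hint_Icc hx ht hθ
  · refine aemeasurable_of_tendsto_metrizable_ae atTop
      (f := fun k : ℕ => supAlong Θ γ (schrodingerTrunc f k)) (fun k => ?_) ?_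
    · exact (measurable_supAlong hγ fun t =>
        ((continuous_bandIntegral (hint_Icc _)).uncurry_left t).const_mul _).aemeasurable
    · filter_upwards [hfinite] with x hx
      exact tendsto_supAlong_schrodingerTrunc hint_Icc hx
  · exact (eLpNorm_mono_enorm fun x => maximalFunction_le_majorant hint_Icc).trans hle

theorem maximalEstimate_of_lt (hΘ : Bornology.IsBounded Θ) (hα : 0 < α) (hC₁ : 0 < C₁)
    (hC₂ : 0 ≤ C₂) (hC₃ : 0 ≤ C₃) (hq1 : 1 ≤ q) (hq2 : q ≤ 2) (hαq : 4 * α ≤ q)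
    (hs : 1 / 2 - α * (1 - upperMinkowskiDim Θ) / q < s) (x₀ r : ℝ) :
    MaximalEstimate Θ α C₁ C₂ C₃ x₀ r s (ENNReal.ofReal (2 * q)) := by
  have hs0 : 0 ≤ s := by
    have hβ : 0 ≤ α * upperMinkowskiDim Θ := mul_nonneg hα.le (upperMinkowskiDim_nonneg hΘ)
    have hdiv : α * (1 - upperMinkowskiDim Θ) / q ≤ 1 / 2 := by
      rw [div_le_iff₀ (by linarith)]
      linarith
    linarith
  obtain ⟨C, hC⟩ := exists_eLpNorm_majorant_le hΘ hα (by linarith) hC₁ hC₂ hC₃ hq1 hαq hs0 hs x₀ r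
  refine maximalEstimate_of_eLpNorm_majorant_le hs0 ?_ ENNReal.ofReal_ne_top hC
  simpa using hq1.trans_lt' one_pos

end MaximalEstimate

end SchrodingerCurves

theorem mainTheorem3_general (Θ : Set ℝ) (hΘ : Bornology.IsBounded Θ) (α C₁ C₂ C₃ : ℝ)
    (hC₁ : 0 < C₁) (hC₂ : 0 ≤ C₂) (hC₃ : 0 ≤ C₃) (x₀ r : ℝ) :
    (1 / 2 ≤ α →
      ∀ s : ℝ, (SchrodingerCurves.upperMinkowskiDim Θ + 1) / 4 < s →
        SchrodingerCurves.MaximalEstimate Θ α C₁ C₂ C₃ x₀ r s 4) ∧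
    (α ∈ Set.Ioo (1 / 4 : ℝ) (1 / 2) →
      ∀ s : ℝ, (SchrodingerCurves.upperMinkowskiDim Θ + 1) / 4 < s →
        SchrodingerCurves.MaximalEstimate Θ α C₁ C₂ C₃ x₀ r s (ENNReal.ofReal (8 * α))) ∧
    (α ∈ Set.Ioc (0 : ℝ) (1 / 4) →
      ∀ s : ℝ, α * SchrodingerCurves.upperMinkowskiDim Θ + 1 / 2 - α < s →
        SchrodingerCurves.MaximalEstimate Θ α C₁ C₂ C₃ x₀ r s 2) := by
  have key := fun {α q s : ℝ} hα hq1 hq2 hαq hs =>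
    SchrodingerCurves.maximalEstimate_of_lt (α := α) (q := q) (s := s) hΘ hα hC₁ hC₂ hC₃ hq1 hq2
      hαq hs x₀ r
  refine ⟨fun hα s hs => ?_, fun ⟨hα4, hα2⟩ s hs => ?_, fun ⟨hα0, hα4⟩ s hs => ?_⟩
  · have h := key (α := 1 / 2) (q := 2) (s := s) (by norm_num) one_le_two le_rfl (by norm_num)
      (by linarith)
    rw [show ENNReal.ofReal (2 * 2) = 4 by norm_num] at h
    exact h.mono_holder (by norm_num) hα hC₂
  · have hα0 : 0 < α := by linarith
    have hs' : 1 / 2 - α * (1 - SchrodingerCurves.upperMinkowskiDim Θ) / (4 * α) < s := by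
      rw [mul_comm 4 α, mul_div_mul_left _ _ hα0.ne']
      linarith
    have h := key hα0 (by linarith) (by linarith) le_rfl hs'
    rwa [show 2 * (4 * α) = 8 * α by ring] at h
  · have h := key (q := 1) (s := s) hα0 le_rfl one_le_two (by linarith) (by linarith)
    rwa [show ENNReal.ofReal (2 * 1) = 2 by norm_num] at h

theorem mainTheorem3 (Θ : Set ℝ) (hΘ : IsCompact Θ) (α C₁ C₂ C₃ : ℝ)
    (hC₁ : 1 ≤ C₁) (hC₂ : 0 < C₂) (hC₃ : 0 < C₃) (x₀ r : ℝ) (hr : 0 < r) :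
    (α ∈ Set.Ico (1 / 2 : ℝ) 1 →
      ∀ s : ℝ, (SchrodingerCurves.upperMinkowskiDim Θ + 1) / 4 < s →
        SchrodingerCurves.MaximalEstimate Θ α C₁ C₂ C₃ x₀ r s 4) ∧
    (α ∈ Set.Ioo (1 / 4 : ℝ) (1 / 2) →
      ∀ s : ℝ, (SchrodingerCurves.upperMinkowskiDim Θ + 1) / 4 < s →
        SchrodingerCurves.MaximalEstimate Θ α C₁ C₂ C₃ x₀ r s (ENNReal.ofReal (8 * α))) ∧
    (α ∈ Set.Ioc (0 : ℝ) (1 / 4) →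
      ∀ s : ℝ, α * SchrodingerCurves.upperMinkowskiDim Θ + 1 / 2 - α < s →
        SchrodingerCurves.MaximalEstimate Θ α C₁ C₂ C₃ x₀ r s 2) :=
  (mainTheorem3_general Θ hΘ.isBounded α C₁ C₂ C₃ (one_pos.trans_le hC₁) hC₂.le hC₃.le
    x₀ r).imp_left fun h hα => h hα.1
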